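/- Let $n\ge 0$, let $p,q$ be probability densities on $\mathbb{R}^n$ with respect to Lebesgue measure, and let $H\in\mathbb{R}^{n\times n}$ be invertible. Let $x$ be a random vector with density $p$ and, for every $\sigma>0$, let $\mathbf{n}_\sigma\sim\mathcal N(0,\sigma^2 I)$ be a Gaussian noise vector independent of $x$; put $y_\sigma = Hx+\mathbf{n}_\sigma$. For $\sigma>0$ let $$p_\sigma(y)=\int_{\mathbb{R}^n} G_\sigma(y-Hx)\,p(x)\,dx,\qquad q_\sigma(y)=\int_{\mathbb{R}^n} G_\sigma(y-Hx)\,q(x)\,dx,\qquad G_\sigma(z)=(2\pi\sigma^2)^{-n/2}e^{-\|z\|_2^2/(2\sigma^2)},$$ be the densities of the noisy measurement when the signal has density $p$, respectively $q$. Then $$D_{\mathrm{KL}}(p\,\|\,q)=\int_0^\infty \mathbb{E}\Big[\big\|\nabla\log p_\sigma(y_\sigma)-\nabla\log q_\sigma(y_\sigma)\big\|_2^2\Big]\,\sigma\,d\sigma ,$$ as an identity in $[0,\infty]$, where the expectation is over $x$ (with density $p$) and the noise. In particular, one side is finite if and only if the other is. -/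

import Mathlib

open MeasureTheory ProbabilityTheory
open scoped ENNReal

/-- `p` is a probability density on `ℝⁿ` with respect to Lebesgue measure. -/
structure IsProbDensity {n : ℕ} (p : EuclideanSpace ℝ (Fin n) → ℝ) : Prop where
  measurable : Measurable p
  nonneg : ∀ x, 0 ≤ p x
  lintegral_eq_one : ∫⁻ x, ENNReal.ofReal (p x) = 1

/-- The distribution on `ℝⁿ` with Lebesgue density `p`. -/
noncomputable def densityMeasure {n : ℕ} (p : EuclideanSpace ℝ (Fin n) → ℝ) :
    Measure (EuclideanSpace ℝ (Fin n)) :=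
  volume.withDensity (fun x => ENNReal.ofReal (p x))

/-- The density `G_σ` of the centred Gaussian distribution `N(0, σ² I)` on `ℝⁿ`. -/
noncomputable def gaussianDensity {n : ℕ} (σ : ℝ) (z : EuclideanSpace ℝ (Fin n)) : ℝ :=
  (2 * Real.pi * σ ^ 2) ^ (-(n : ℝ) / 2) * Real.exp (-‖z‖ ^ 2 / (2 * σ ^ 2))

/-- The density `y ↦ ∫ G_σ (y - H x) p(x) dx` of the noisy measurement `y_σ = H x + n`, where
`x` has density `p` and `n ∼ N(0, σ² I)` is independent of `x`. -/
noncomputable def noisyMeasurementDensity {n : ℕ} (H : Matrix (Fin n) (Fin n) ℝ)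
    (p : EuclideanSpace ℝ (Fin n) → ℝ) (σ : ℝ) (y : EuclideanSpace ℝ (Fin n)) : ℝ :=
  ∫ x, gaussianDensity σ (y - H.toEuclideanLin x) * p x

/-- The score `∇ log p_σ` of the noisy measurement density `p_σ`. -/
noncomputable def noisyMeasurementScore {n : ℕ} (H : Matrix (Fin n) (Fin n) ℝ)
    (p : EuclideanSpace ℝ (Fin n) → ℝ) (σ : ℝ) (y : EuclideanSpace ℝ (Fin n)) :
    EuclideanSpace ℝ (Fin n) :=
  gradient (fun y' => Real.log (noisyMeasurementDensity H p σ y')) y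

/-! ### The Gaussian density and its derivatives -/

section GaussianDensity

variable {n : ℕ}

/-! This is de Bruijn's identity integrated over all noise levels. Let u and v be the Gaussian
smoothings, at level σ, of two measures of equal mass. Since ∂_σ G_σ = σ ΔG_σ, differentiating ∫ u
log(u/v) in σ and integrating by parts gives −σ ∫ u ‖∇log u − ∇log v‖²
(`hasDerivAt_smoothedEntropy`). As σ → ∞ the smoothings merge in L¹ and the entropy tends to 0. As σ
→ 0 they return to the original densities and the entropy tends to the unsmoothed one. The
fundamental theorem of calculus then gives the identity
(`ComparableDensities.integral_fisherDensity`).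

The analysis needs log(u/v) bounded, so it is carried out for densities whose ratio lies in [1/c,
c]; smoothing preserves such a comparison. General p, q are replaced by the mixtures p + εq and q +
εp. For these, both the entropy integrand and the Fisher integrand are bounded pointwise by their
values at ε = 0 and converge to them as ε → 0. Fatou's lemma together with this bound passes to the
limit on both sides, infinite values included (`tendsto_lintegral_of_le_of_tendsto`).

An invertible H changes nothing: Hx again has a density, the noisy density is the smoothing of the
law of Hx, and the divergence is invariant under injective maps with a measurable inverse. -/

theorem gaussianDensity_pos {σ : ℝ} (hσ : 0 < σ) (z : EuclideanSpace ℝ (Fin n)) :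
    0 < gaussianDensity σ z := by
  unfold gaussianDensity
  positivity

theorem gaussianDensity_nonneg (σ : ℝ) (z : EuclideanSpace ℝ (Fin n)) :
    0 ≤ gaussianDensity σ z := by
  unfold gaussianDensity
  positivity

theorem continuous_gaussianDensity (σ : ℝ) :
    Continuous (gaussianDensity σ : EuclideanSpace ℝ (Fin n) → ℝ) := by
  unfold gaussianDensity
  fun_prop

/-- The partial derivative `∂ᵢ G_σ`. -/
noncomputable def gaussianPartial (σ : ℝ) (i : Fin n) (z : EuclideanSpace ℝ (Fin n)) : ℝ :=
  -(z i / σ ^ 2) * gaussianDensity σ z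

/-- The second partial derivative `∂ᵢ² G_σ`. -/
noncomputable def gaussianPartialTwo (σ : ℝ) (i : Fin n) (z : EuclideanSpace ℝ (Fin n)) : ℝ :=
  ((z i) ^ 2 / σ ^ 4 - 1 / σ ^ 2) * gaussianDensity σ z

/-- The Fréchet derivative of `∂ᵢ G_σ`. -/
noncomputable def gaussianPartialFDeriv (σ : ℝ) (i : Fin n) (z : EuclideanSpace ℝ (Fin n)) :
    EuclideanSpace ℝ (Fin n) →L[ℝ] ℝ :=
  ((z i / σ ^ 4) * gaussianDensity σ z) • innerSL ℝ z
    - (1 / σ ^ 2 * gaussianDensity σ z) • EuclideanSpace.proj (𝕜 := ℝ) i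

theorem continuous_gaussianPartial (σ : ℝ) (i : Fin n) : Continuous (gaussianPartial σ i) := by
  have := continuous_gaussianDensity (n := n) σ
  unfold gaussianPartial
  fun_prop

theorem continuous_gaussianPartialTwo (σ : ℝ) (i : Fin n) :
    Continuous (gaussianPartialTwo σ i) := by
  have := continuous_gaussianDensity (n := n) σ
  unfold gaussianPartialTwo
  fun_prop

theorem continuous_gaussianPartialFDeriv (σ : ℝ) (i : Fin n) :
    Continuous (gaussianPartialFDeriv σ i) := by
  have := continuous_gaussianDensity (n := n) σ
  unfold gaussianPartialFDeriv
  fun_prop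

/-- At σ = 0 this still holds: division by zero makes the function constant and the derivative zero.
-/
theorem hasFDerivAt_gaussianDensity (σ : ℝ) (z : EuclideanSpace ℝ (Fin n)) :
    HasFDerivAt (gaussianDensity σ)
      ((-(1 / σ ^ 2) * gaussianDensity σ z) • innerSL ℝ z) z := by
  have h1 : HasFDerivAt (fun z : EuclideanSpace ℝ (Fin n) => ‖z‖ ^ 2) (2 • innerSL ℝ z) z :=
    (hasStrictFDerivAt_norm_sq z).hasFDerivAt
  have h2 := ((h1.const_mul (-(1 / (2 * σ ^ 2)))).exp).const_mul
    ((2 * Real.pi * σ ^ 2) ^ (-(n : ℝ) / 2))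
  convert! h2 using 1
  · ext w
    unfold gaussianDensity
    congr 2
    ring
  · ext w
    simp only [gaussianDensity, smul_apply, smul_eq_mul, nsmul_eq_mul,
      innerSL_apply_apply]
    rw [show -‖z‖ ^ 2 / (2 * σ ^ 2) = -(1 / (2 * σ ^ 2)) * ‖z‖ ^ 2 by ring]
    push_cast
    ring

theorem hasFDerivAt_gaussianPartial {σ : ℝ} (i : Fin n) (z : EuclideanSpace ℝ (Fin n)) :
    HasFDerivAt (gaussianPartial σ i) (gaussianPartialFDeriv σ i z) z := by
  have h1 : HasFDerivAt (fun z : EuclideanSpace ℝ (Fin n) => z i)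
      (EuclideanSpace.proj (𝕜 := ℝ) i : EuclideanSpace ℝ (Fin n) →L[ℝ] ℝ) z :=
    (EuclideanSpace.proj (𝕜 := ℝ) i : EuclideanSpace ℝ (Fin n) →L[ℝ] ℝ).hasFDerivAt
  have h2 := (h1.const_mul (-(1 / σ ^ 2))).mul (hasFDerivAt_gaussianDensity σ z)
  convert! h2 using 1
  · ext w
    simp only [gaussianPartial, Pi.mul_apply]
    ring
  · ext w
    simp only [gaussianPartialFDeriv, smul_apply, smul_eq_mul,
      sub_apply, add_apply, innerSL_apply_apply,
      PiLp.proj_apply]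
    ring

theorem gaussianPartialFDeriv_single (σ : ℝ) (i : Fin n) (z : EuclideanSpace ℝ (Fin n)) :
    gaussianPartialFDeriv σ i z (EuclideanSpace.single i 1) = gaussianPartialTwo σ i z := by
  simp only [gaussianPartialFDeriv, gaussianPartialTwo, smul_apply,
    smul_eq_mul, sub_apply, innerSL_apply_apply, PiLp.proj_apply,
    EuclideanSpace.inner_single_right]
  simp
  ring

/-- The heat equation for the Gaussian density, in terms of the standard deviation. -/
theorem hasDerivAt_gaussianDensity {σ : ℝ} (hσ : 0 < σ) (z : EuclideanSpace ℝ (Fin n)) :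
    HasDerivAt (fun s => gaussianDensity s z) (σ * ∑ i, gaussianPartialTwo σ i z) σ := by
  have h0 : (2 * Real.pi * σ ^ 2) ≠ 0 := by positivity
  have h1 : HasDerivAt (fun s : ℝ => 2 * Real.pi * s ^ 2) (2 * Real.pi * (2 * σ)) σ := by
    simpa using (hasDerivAt_pow 2 σ).const_mul (2 * Real.pi)
  have h2 := h1.rpow_const (p := -(n : ℝ) / 2) (Or.inl h0)
  have h3 : HasDerivAt (fun s : ℝ => -‖z‖ ^ 2 / (2 * s ^ 2)) (‖z‖ ^ 2 / σ ^ 3) σ := by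
    have h4 : HasDerivAt (fun s : ℝ => 2 * s ^ 2) (2 * (2 * σ)) σ := by
      simpa using (hasDerivAt_pow 2 σ).const_mul 2
    convert! (hasDerivAt_const σ (-‖z‖ ^ 2)).div h4 (by positivity) using 1
    field_simp
    ring
  convert! h2.mul h3.exp using 1
  have h5 : ∑ i, gaussianPartialTwo σ i z =
      (‖z‖ ^ 2 / σ ^ 4 - n / σ ^ 2) * gaussianDensity σ z := by
    simp only [gaussianPartialTwo]
    rw [← Finset.sum_mul, Finset.sum_sub_distrib, ← Finset.sum_div, EuclideanSpace.norm_sq_eq]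
    simp [div_eq_mul_inv]
  rw [h5, gaussianDensity, Real.rpow_sub_one h0]
  field_simp
  ring

theorem integrable_exp_neg_mul_norm_sq {b : ℝ} (hb : 0 < b) :
    Integrable (fun z : EuclideanSpace ℝ (Fin n) => Real.exp (-b * ‖z‖ ^ 2)) := by
  have h := (GaussianFourier.integrable_cexp_neg_mul_sq_norm_add
    (V := EuclideanSpace ℝ (Fin n)) (b := (b : ℂ)) (by simpa using hb) 0 0).re
  refine h.congr (Filter.Eventually.of_forall fun z => ?_)
  simp only [zero_mul, add_zero]
  have : (-(b : ℂ) * (‖z‖ : ℂ) ^ 2) = ((-b * ‖z‖ ^ 2 : ℝ) : ℂ) := by push_cast; ring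
  rw [this, ← Complex.ofReal_exp]
  rfl

theorem gaussianDensity_eq_mul_exp (σ : ℝ) (z : EuclideanSpace ℝ (Fin n)) :
    gaussianDensity σ z =
      (2 * Real.pi * σ ^ 2) ^ (-(n : ℝ) / 2) * Real.exp (-(1 / (2 * σ ^ 2)) * ‖z‖ ^ 2) := by
  unfold gaussianDensity
  congr 2
  ring

theorem integrable_gaussianDensity {σ : ℝ} (hσ : 0 < σ) :
    Integrable (gaussianDensity σ : EuclideanSpace ℝ (Fin n) → ℝ) := by
  have := (integrable_exp_neg_mul_norm_sq (n := n) (b := 1 / (2 * σ ^ 2))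
    (by positivity)).const_mul ((2 * Real.pi * σ ^ 2) ^ (-(n : ℝ) / 2))
  exact this.congr (Filter.Eventually.of_forall fun z => (gaussianDensity_eq_mul_exp σ z).symm)

theorem integral_gaussianDensity {σ : ℝ} (hσ : 0 < σ) :
    ∫ z : EuclideanSpace ℝ (Fin n), gaussianDensity σ z = 1 := by
  simp_rw [gaussianDensity_eq_mul_exp]
  rw [integral_const_mul, GaussianFourier.integral_rexp_neg_mul_sq_norm (by positivity)]
  rw [show Real.pi / (1 / (2 * σ ^ 2)) = 2 * Real.pi * σ ^ 2 by field_simp]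
  rw [← Real.rpow_add (by positivity)]
  simp
  ring_nf
  exact Real.rpow_zero _

/-- Scaling turns questions about G_σ into questions about G_1 at a rescaled argument; both L¹
limits below rest on this. -/
theorem gaussianDensity_smul {σ : ℝ} (hσ : 0 < σ) (z : EuclideanSpace ℝ (Fin n)) :
    σ ^ n * gaussianDensity σ (σ • z) = gaussianDensity 1 z := by
  unfold gaussianDensity
  rw [norm_smul, Real.norm_of_nonneg hσ.le, Real.mul_rpow (by positivity) (by positivity),
    ← Real.rpow_natCast σ 2, ← Real.rpow_mul hσ.le]
  rw [show ((2 : ℕ) : ℝ) * (-(n : ℝ) / 2) = -(n : ℝ) by push_cast; ring, Real.rpow_neg hσ.le,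
    Real.rpow_natCast, Real.rpow_natCast]
  have : -(σ * ‖z‖) ^ 2 / (2 * σ ^ 2) = -‖z‖ ^ 2 / (2 * 1 ^ 2) := by field_simp
  rw [this]
  field_simp

/-- Gaussian envelope of the Gaussian densities with standard deviations in `[a, b]`. -/
theorem one_add_norm_sq_mul_gaussianDensity_le {a b σ : ℝ} (ha : 0 < a) (h1 : a ≤ σ) (h2 : σ ≤ b)
    (z : EuclideanSpace ℝ (Fin n)) :
    (1 + ‖z‖ ^ 2) * gaussianDensity σ z ≤
      (2 * Real.pi * a ^ 2) ^ (-(n : ℝ) / 2) * (1 + 4 * b ^ 2) *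
        Real.exp (-(1 / (4 * b ^ 2)) * ‖z‖ ^ 2) := by
  have hσ : 0 < σ := ha.trans_le h1
  have hb : 0 < b := hσ.trans_le h2
  rw [gaussianDensity_eq_mul_exp]
  have e1 : (2 * Real.pi * σ ^ 2) ^ (-(n : ℝ) / 2) ≤ (2 * Real.pi * a ^ 2) ^ (-(n : ℝ) / 2) := by
    apply Real.rpow_le_rpow_of_nonpos (by positivity) (by gcongr)
    have : (0 : ℝ) ≤ n := by positivity
    linarith
  have e2 : Real.exp (-(1 / (2 * σ ^ 2)) * ‖z‖ ^ 2) ≤ Real.exp (-(1 / (2 * b ^ 2)) * ‖z‖ ^ 2) := by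
    gcongr
  -- Half of the exponent is spent on the polynomial factor: with s = ‖z‖²/(4b²), exp(−2s) =
  -- exp(−s)·exp(−s), and s·exp(−s) ≤ 1.
  have e3 : (1 + ‖z‖ ^ 2) * Real.exp (-(1 / (2 * b ^ 2)) * ‖z‖ ^ 2) ≤
      (1 + 4 * b ^ 2) * Real.exp (-(1 / (4 * b ^ 2)) * ‖z‖ ^ 2) := by
    set s := 1 / (4 * b ^ 2) * ‖z‖ ^ 2 with hs
    have hs0 : 0 ≤ s := by positivity
    have hz : ‖z‖ ^ 2 = 4 * b ^ 2 * s := by rw [hs]; field_simp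
    rw [show -(1 / (2 * b ^ 2)) * ‖z‖ ^ 2 = -s + -s by rw [hs]; field_simp; ring,
      show -(1 / (4 * b ^ 2)) * ‖z‖ ^ 2 = -s by rw [hs]; ring, Real.exp_add, hz, ← mul_assoc]
    apply mul_le_mul_of_nonneg_right _ (Real.exp_pos _).le
    have e4 : Real.exp (-s) ≤ 1 := Real.exp_le_one_iff.2 (by linarith)
    have e5 : s * Real.exp (-s) ≤ 1 := by
      rw [Real.exp_neg, ← div_eq_mul_inv, div_le_one (Real.exp_pos _)]
      linarith [Real.add_one_le_exp s]
    nlinarith [mul_le_mul_of_nonneg_left e5 (by positivity : 0 ≤ 4 * b ^ 2)]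
  calc (1 + ‖z‖ ^ 2) * ((2 * Real.pi * σ ^ 2) ^ (-(n : ℝ) / 2) *
        Real.exp (-(1 / (2 * σ ^ 2)) * ‖z‖ ^ 2))
      ≤ (1 + ‖z‖ ^ 2) * ((2 * Real.pi * a ^ 2) ^ (-(n : ℝ) / 2) *
        Real.exp (-(1 / (2 * b ^ 2)) * ‖z‖ ^ 2)) := by gcongr
    _ = (2 * Real.pi * a ^ 2) ^ (-(n : ℝ) / 2) *
        ((1 + ‖z‖ ^ 2) * Real.exp (-(1 / (2 * b ^ 2)) * ‖z‖ ^ 2)) := by ring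
    _ ≤ (2 * Real.pi * a ^ 2) ^ (-(n : ℝ) / 2) *
        ((1 + 4 * b ^ 2) * Real.exp (-(1 / (4 * b ^ 2)) * ‖z‖ ^ 2)) := by gcongr
    _ = _ := by ring

theorem sq_apply_le_norm_sq (z : EuclideanSpace ℝ (Fin n)) (i : Fin n) : (z i) ^ 2 ≤ ‖z‖ ^ 2 := by
  rw [EuclideanSpace.norm_sq_eq]
  simp_rw [Real.norm_eq_abs, sq_abs]
  exact Finset.single_le_sum (f := fun j => (z j) ^ 2) (fun j _ => sq_nonneg _) (Finset.mem_univ i)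

/-- Bounds on all derivatives of G_σ are put in the common form C(1 + ‖z‖²)G_σ, so that one Gaussian
envelope serves for all. Here |t| ≤ 1 + t² suffices. -/
theorem abs_gaussianPartial_le (σ : ℝ) (i : Fin n) (z : EuclideanSpace ℝ (Fin n)) :
    |gaussianPartial σ i z| ≤ 1 / σ ^ 2 * ((1 + ‖z‖ ^ 2) * gaussianDensity σ z) := by
  rw [gaussianPartial, abs_mul, abs_of_nonneg (gaussianDensity_nonneg σ z), abs_neg, abs_div,
    abs_of_nonneg (sq_nonneg σ), ← mul_assoc]
  apply mul_le_mul_of_nonneg_right _ (gaussianDensity_nonneg σ z)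
  rw [div_eq_inv_mul, one_div]
  gcongr
  have := sq_apply_le_norm_sq z i
  rw [← sq_abs] at this
  nlinarith [sq_nonneg (|z i| - 1), abs_nonneg (z i)]

theorem abs_gaussianPartialTwo_le (σ : ℝ) (i : Fin n) (z : EuclideanSpace ℝ (Fin n)) :
    |gaussianPartialTwo σ i z| ≤
      (1 / σ ^ 4 + 1 / σ ^ 2) * ((1 + ‖z‖ ^ 2) * gaussianDensity σ z) := by
  rw [gaussianPartialTwo, abs_mul, abs_of_nonneg (gaussianDensity_nonneg σ z), ← mul_assoc]
  apply mul_le_mul_of_nonneg_right _ (gaussianDensity_nonneg σ z)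
  have := sq_apply_le_norm_sq z i
  have h1 : 0 ≤ 1 / σ ^ 4 := by positivity
  have h2 : 0 ≤ 1 / σ ^ 2 := by positivity
  rw [div_eq_mul_one_div]
  have h3 := mul_le_mul_of_nonneg_right this h1
  have h4 : 0 ≤ z i ^ 2 * (1 / σ ^ 4) := by positivity
  have h5 : 0 ≤ ‖z‖ ^ 2 * (1 / σ ^ 2) := by positivity
  rw [abs_le]
  constructor <;> nlinarith

theorem norm_gaussianPartialFDeriv_le (σ : ℝ) (i : Fin n) (z : EuclideanSpace ℝ (Fin n)) :
    ‖gaussianPartialFDeriv σ i z‖ ≤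
      (1 / σ ^ 4 + 1 / σ ^ 2) * ((1 + ‖z‖ ^ 2) * gaussianDensity σ z) := by
  have hg := gaussianDensity_nonneg σ z
  have hi : |z i| ≤ ‖z‖ := by
    simpa using PiLp.norm_apply_le z i
  have hp : ‖(EuclideanSpace.proj (𝕜 := ℝ) i : EuclideanSpace ℝ (Fin n) →L[ℝ] ℝ)‖ ≤ 1 := by
    refine ContinuousLinearMap.opNorm_le_bound _ zero_le_one fun w => ?_
    simpa using PiLp.norm_apply_le w i
  refine (norm_sub_le _ _).trans ?_
  rw [norm_smul, norm_smul, innerSL_apply_norm, Real.norm_eq_abs, Real.norm_eq_abs, abs_mul,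
    abs_mul, abs_div, abs_of_nonneg hg, abs_of_nonneg (by positivity : 0 ≤ 1 / σ ^ 2),
    abs_of_nonneg (by positivity : 0 ≤ σ ^ 4)]
  have h1 : |z i| / σ ^ 4 * gaussianDensity σ z * ‖z‖ ≤
      ‖z‖ / σ ^ 4 * gaussianDensity σ z * ‖z‖ := by gcongr
  have h2 : 1 / σ ^ 2 * gaussianDensity σ z *
      ‖(EuclideanSpace.proj (𝕜 := ℝ) i : EuclideanSpace ℝ (Fin n) →L[ℝ] ℝ)‖ ≤
      1 / σ ^ 2 * gaussianDensity σ z * 1 := by gcongr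
  refine (add_le_add h1 h2).trans ?_
  have h3 : 0 ≤ 1 / σ ^ 4 * gaussianDensity σ z := by positivity
  have h4 : 0 ≤ 1 / σ ^ 2 * ‖z‖ ^ 2 * gaussianDensity σ z := by positivity
  calc ‖z‖ / σ ^ 4 * gaussianDensity σ z * ‖z‖ + 1 / σ ^ 2 * gaussianDensity σ z * 1
      = 1 / σ ^ 4 * ‖z‖ ^ 2 * gaussianDensity σ z + 1 / σ ^ 2 * gaussianDensity σ z := by ring
    _ ≤ _ := by nlinarith

theorem exists_one_add_norm_sq_mul_gaussianDensity_le {σ : ℝ} (hσ : 0 < σ) :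
    ∃ C, 0 ≤ C ∧ ∀ z : EuclideanSpace ℝ (Fin n), (1 + ‖z‖ ^ 2) * gaussianDensity σ z ≤ C := by
  refine ⟨(2 * Real.pi * σ ^ 2) ^ (-(n : ℝ) / 2) * (1 + 4 * σ ^ 2), by positivity, fun z => ?_⟩
  refine (one_add_norm_sq_mul_gaussianDensity_le hσ le_rfl le_rfl z).trans ?_
  refine mul_le_of_le_one_right (by positivity) (Real.exp_le_one_iff.2 ?_)
  have : 0 ≤ 1 / (4 * σ ^ 2) * ‖z‖ ^ 2 := by positivity
  linarith

theorem integrable_of_abs_le_gaussianDensity {σ : ℝ} (hσ : 0 < σ) {C : ℝ}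
    {k : EuclideanSpace ℝ (Fin n) → ℝ} (hk : Continuous k)
    (hC : ∀ z, |k z| ≤ C * ((1 + ‖z‖ ^ 2) * gaussianDensity σ z)) : Integrable k := by
  have h := (integrable_exp_neg_mul_norm_sq (n := n) (b := 1 / (4 * σ ^ 2))
    (by positivity)).const_mul (|C| * ((2 * Real.pi * σ ^ 2) ^ (-(n : ℝ) / 2) * (1 + 4 * σ ^ 2)))
  refine h.mono' hk.aestronglyMeasurable (Filter.Eventually.of_forall fun z => ?_)
  have h1 := one_add_norm_sq_mul_gaussianDensity_le hσ le_rfl le_rfl z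
  have h2 : 0 ≤ (1 + ‖z‖ ^ 2) * gaussianDensity σ z :=
    mul_nonneg (by positivity) (gaussianDensity_nonneg σ z)
  calc ‖k z‖ ≤ C * ((1 + ‖z‖ ^ 2) * gaussianDensity σ z) := hC z
    _ ≤ |C| * ((1 + ‖z‖ ^ 2) * gaussianDensity σ z) := by gcongr; exact le_abs_self C
    _ ≤ |C| * _ := mul_le_mul_of_nonneg_left h1 (abs_nonneg C)
    _ = _ := (mul_assoc _ _ _).symm

theorem integrable_gaussianPartial {σ : ℝ} (hσ : 0 < σ) (i : Fin n) :
    Integrable (gaussianPartial σ i) :=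
  integrable_of_abs_le_gaussianDensity hσ (continuous_gaussianPartial σ i)
    (abs_gaussianPartial_le σ i)

theorem integrable_gaussianPartialTwo {σ : ℝ} (hσ : 0 < σ) (i : Fin n) :
    Integrable (gaussianPartialTwo σ i) :=
  integrable_of_abs_le_gaussianDensity hσ (continuous_gaussianPartialTwo σ i)
    (abs_gaussianPartialTwo_le σ i)

theorem integrable_sq_mul_gaussianDensity {σ : ℝ} (hσ : 0 < σ) (i : Fin n) :
    Integrable (fun z : EuclideanSpace ℝ (Fin n) => (z i) ^ 2 * gaussianDensity σ z) := by
  have := continuous_gaussianDensity (n := n) σ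
  refine integrable_of_abs_le_gaussianDensity hσ (C := 1) (by fun_prop) fun z => ?_
  have hg := gaussianDensity_nonneg σ z
  rw [abs_of_nonneg (by positivity), one_mul]
  gcongr
  linarith [sq_apply_le_norm_sq z i]

end GaussianDensity

/-! ### Smoothing a finite measure by a kernel -/

section KernelSmoothing

variable {n : ℕ}

/-- The convolution `y ↦ ∫ k (y - x) dα(x)` of a kernel with a measure. -/
noncomputable def kernelSmoothing (k : EuclideanSpace ℝ (Fin n) → ℝ)
    (α : Measure (EuclideanSpace ℝ (Fin n))) (y : EuclideanSpace ℝ (Fin n)) : ℝ :=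
  ∫ x, k (y - x) ∂α

variable {k : EuclideanSpace ℝ (Fin n) → ℝ} {α : Measure (EuclideanSpace ℝ (Fin n))}

theorem integrable_kernel_sub [IsFiniteMeasure α] (hk : Continuous k) {C : ℝ}
    (hC : ∀ z, |k z| ≤ C) (y : EuclideanSpace ℝ (Fin n)) :
    Integrable (fun x => k (y - x)) α :=
  (integrable_const C).mono' (by fun_prop) (Filter.Eventually.of_forall fun x => hC (y - x))

theorem integrable_prod_kernel_sub [IsFiniteMeasure α] (hk : Continuous k) (hi : Integrable k) :
    Integrable (fun w : EuclideanSpace ℝ (Fin n) × EuclideanSpace ℝ (Fin n) => k (w.1 - w.2))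
      ((volume : Measure (EuclideanSpace ℝ (Fin n))).prod α) := by
  rw [integrable_prod_iff' (by fun_prop)]
  refine ⟨Filter.Eventually.of_forall fun x => hi.comp_sub_right x, ?_⟩
  have : ∀ x, ∫ y, ‖k (y - x)‖ = ∫ y, ‖k y‖ :=
    fun x => integral_sub_right_eq_self (fun y => ‖k y‖) x
  simp_rw [this]
  exact integrable_const _

theorem integrable_kernelSmoothing [IsFiniteMeasure α] (hk : Continuous k) (hi : Integrable k) :
    Integrable (kernelSmoothing k α) :=
  (integrable_prod_kernel_sub hk hi).integral_prod_left

/-- The derivative falls on the kernel; a constant bound on `k'` dominates because α is finite. -/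
theorem hasFDerivAt_kernelSmoothing [IsFiniteMeasure α]
    {k' : EuclideanSpace ℝ (Fin n) → EuclideanSpace ℝ (Fin n) →L[ℝ] ℝ}
    (hk : ∀ z, HasFDerivAt k (k' z) z) (hk' : Continuous k') {C C' : ℝ} (hC : ∀ z, |k z| ≤ C)
    (hC' : ∀ z, ‖k' z‖ ≤ C') (y : EuclideanSpace ℝ (Fin n)) :
    HasFDerivAt (kernelSmoothing k α) (∫ x, k' (y - x) ∂α) y := by
  have hkc : Continuous k := continuous_iff_continuousAt.2 fun z => (hk z).continuousAt
  refine hasFDerivAt_integral_of_dominated_of_fderiv_le (F := fun y x => k (y - x))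
    (F' := fun y x => k' (y - x)) (bound := fun _ => C') Filter.univ_mem
    (Filter.Eventually.of_forall fun y => ?_) (integrable_kernel_sub hkc hC y) ?_
    (Filter.Eventually.of_forall fun x y _ => hC' _) (integrable_const _)
    (Filter.Eventually.of_forall fun x y _ => ?_)
  · exact Continuous.aestronglyMeasurable (by fun_prop)
  · exact Continuous.aestronglyMeasurable (by fun_prop)
  · simpa [Function.comp_def] using (hk (y - x)).comp y ((hasFDerivAt_id y).sub_const x)

/-- Line derivatives are the form in which the coordinatewise integration by parts is applied later.
-/
theorem hasLineDerivAt_kernelSmoothing [IsFiniteMeasure α]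
    {k' : EuclideanSpace ℝ (Fin n) → EuclideanSpace ℝ (Fin n) →L[ℝ] ℝ}
    (hk : ∀ z, HasFDerivAt k (k' z) z) (hk' : Continuous k') {C C' : ℝ} (hC : ∀ z, |k z| ≤ C)
    (hC' : ∀ z, ‖k' z‖ ≤ C') (y v : EuclideanSpace ℝ (Fin n)) :
    HasLineDerivAt ℝ (kernelSmoothing k α) (kernelSmoothing (fun z => k' z v) α y) y v := by
  have h := (hasFDerivAt_kernelSmoothing (α := α) hk hk' hC hC' y).hasLineDerivAt v
  rwa [ContinuousLinearMap.integral_apply] at h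
  exact (integrable_const C').mono' (Continuous.aestronglyMeasurable (by fun_prop))
    (Filter.Eventually.of_forall fun x => hC' (y - x))

end KernelSmoothing

/-! ### Smoothing a finite measure by a Gaussian -/

section GaussianSmoothing

variable {n : ℕ} {σ : ℝ} {α : Measure (EuclideanSpace ℝ (Fin n))}

theorem exists_gaussianDensity_le (hσ : 0 < σ) :
    ∃ C, ∀ z : EuclideanSpace ℝ (Fin n), |gaussianDensity σ z| ≤ C := by
  obtain ⟨C, -, hC⟩ := exists_one_add_norm_sq_mul_gaussianDensity_le (n := n) hσ
  refine ⟨C, fun z => ?_⟩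
  have h := gaussianDensity_nonneg σ z
  rw [abs_of_nonneg h]
  refine le_trans ?_ (hC z)
  nlinarith [sq_nonneg ‖z‖, mul_nonneg (sq_nonneg ‖z‖) h]

theorem exists_gaussianPartial_le (hσ : 0 < σ) (i : Fin n) :
    ∃ C, ∀ z, |gaussianPartial σ i z| ≤ C := by
  obtain ⟨C, -, hC⟩ := exists_one_add_norm_sq_mul_gaussianDensity_le (n := n) hσ
  exact ⟨_, fun z => (abs_gaussianPartial_le σ i z).trans
    (mul_le_mul_of_nonneg_left (hC z) (by positivity))⟩

theorem exists_gaussianPartialTwo_le (hσ : 0 < σ) (i : Fin n) :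
    ∃ C, ∀ z, |gaussianPartialTwo σ i z| ≤ C := by
  obtain ⟨C, -, hC⟩ := exists_one_add_norm_sq_mul_gaussianDensity_le (n := n) hσ
  exact ⟨_, fun z => (abs_gaussianPartialTwo_le σ i z).trans
    (mul_le_mul_of_nonneg_left (hC z) (by positivity))⟩

theorem exists_gaussianPartialFDeriv_le (hσ : 0 < σ) (i : Fin n) :
    ∃ C, ∀ z, ‖gaussianPartialFDeriv σ i z‖ ≤ C := by
  obtain ⟨C, -, hC⟩ := exists_one_add_norm_sq_mul_gaussianDensity_le (n := n) hσ
  exact ⟨_, fun z => (norm_gaussianPartialFDeriv_le σ i z).trans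
    (mul_le_mul_of_nonneg_left (hC z) (by positivity))⟩

theorem exists_gaussianFDeriv_le (hσ : 0 < σ) :
    ∃ C, ∀ z : EuclideanSpace ℝ (Fin n),
      ‖(-(1 / σ ^ 2) * gaussianDensity σ z) • innerSL ℝ z‖ ≤ C := by
  obtain ⟨C, -, hC⟩ := exists_one_add_norm_sq_mul_gaussianDensity_le (n := n) hσ
  refine ⟨1 / σ ^ 2 * C, fun z => ?_⟩
  have h := gaussianDensity_nonneg σ z
  rw [norm_smul, innerSL_apply_norm, norm_mul, norm_neg, Real.norm_of_nonneg h,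
    Real.norm_of_nonneg (by positivity), mul_assoc]
  gcongr
  refine le_trans ?_ (hC z)
  rw [mul_comm]
  gcongr
  nlinarith [sq_nonneg (‖z‖ - 1), norm_nonneg z]

theorem integrable_gaussianDensity_sub [IsFiniteMeasure α] (hσ : 0 < σ)
    (y : EuclideanSpace ℝ (Fin n)) : Integrable (fun x => gaussianDensity σ (y - x)) α := by
  obtain ⟨C, hC⟩ := exists_gaussianDensity_le (n := n) hσ
  exact integrable_kernel_sub (continuous_gaussianDensity σ) hC y

/-- The Gaussian smoothing `G_σ * α` of a measure. -/
noncomputable def gaussianSmoothing (σ : ℝ) (α : Measure (EuclideanSpace ℝ (Fin n))) :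
    EuclideanSpace ℝ (Fin n) → ℝ :=
  kernelSmoothing (gaussianDensity σ) α

/-- The partial derivative `∂ᵢ (G_σ * α)`. -/
noncomputable def gaussianSmoothingPartial (σ : ℝ) (α : Measure (EuclideanSpace ℝ (Fin n)))
    (i : Fin n) : EuclideanSpace ℝ (Fin n) → ℝ :=
  kernelSmoothing (gaussianPartial σ i) α

/-- The second partial derivative `∂ᵢ² (G_σ * α)`. -/
noncomputable def gaussianSmoothingPartialTwo (σ : ℝ) (α : Measure (EuclideanSpace ℝ (Fin n)))
    (i : Fin n) : EuclideanSpace ℝ (Fin n) → ℝ :=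
  kernelSmoothing (gaussianPartialTwo σ i) α

theorem gaussianSmoothing_nonneg (σ : ℝ) (α : Measure (EuclideanSpace ℝ (Fin n)))
    (y : EuclideanSpace ℝ (Fin n)) : 0 ≤ gaussianSmoothing σ α y :=
  integral_nonneg fun _ => gaussianDensity_nonneg _ _

theorem gaussianSmoothing_pos [IsFiniteMeasure α] [NeZero α] (hσ : 0 < σ)
    (y : EuclideanSpace ℝ (Fin n)) : 0 < gaussianSmoothing σ α y := by
  unfold gaussianSmoothing kernelSmoothing
  rw [integral_pos_iff_support_of_nonneg (fun _ => gaussianDensity_nonneg _ _)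
    (integrable_gaussianDensity_sub hσ y)]
  have : (Function.support fun x => gaussianDensity σ (y - x)) = Set.univ := by
    ext x
    simp [(gaussianDensity_pos hσ (y - x)).ne']
  rw [this]
  exact Measure.measure_univ_pos.2 (NeZero.ne α)

theorem hasFDerivAt_gaussianSmoothing [IsFiniteMeasure α] (hσ : 0 < σ)
    (y : EuclideanSpace ℝ (Fin n)) :
    HasFDerivAt (gaussianSmoothing σ α)
      (∫ x, (-(1 / σ ^ 2) * gaussianDensity σ (y - x)) • innerSL ℝ (y - x) ∂α) y := by
  obtain ⟨C, hC⟩ := exists_gaussianDensity_le (n := n) hσ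
  obtain ⟨C', hC'⟩ := exists_gaussianFDeriv_le (n := n) hσ
  have := continuous_gaussianDensity (n := n) σ
  exact hasFDerivAt_kernelSmoothing (hasFDerivAt_gaussianDensity σ) (by fun_prop) hC hC' y

theorem hasLineDerivAt_gaussianSmoothing [IsFiniteMeasure α] (hσ : 0 < σ) (i : Fin n)
    (y : EuclideanSpace ℝ (Fin n)) :
    HasLineDerivAt ℝ (gaussianSmoothing σ α) (gaussianSmoothingPartial σ α i y) y
      (EuclideanSpace.single i 1) := by
  obtain ⟨C, hC⟩ := exists_gaussianDensity_le (n := n) hσ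
  obtain ⟨C', hC'⟩ := exists_gaussianFDeriv_le (n := n) hσ
  have := continuous_gaussianDensity (n := n) σ
  have e : gaussianPartial σ i = fun z => ((-(1 / σ ^ 2) * gaussianDensity σ z) • innerSL ℝ z)
      (EuclideanSpace.single i 1) := by
    ext z
    simp only [gaussianPartial, smul_apply, innerSL_apply_apply, smul_eq_mul,
      EuclideanSpace.inner_single_right]
    simp
    ring
  unfold gaussianSmoothingPartial
  rw [e]
  exact hasLineDerivAt_kernelSmoothing (hasFDerivAt_gaussianDensity σ) (by fun_prop)
    hC hC' y (EuclideanSpace.single i 1)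

theorem hasLineDerivAt_gaussianSmoothingPartial [IsFiniteMeasure α] (hσ : 0 < σ) (i : Fin n)
    (y : EuclideanSpace ℝ (Fin n)) :
    HasLineDerivAt ℝ (gaussianSmoothingPartial σ α i) (gaussianSmoothingPartialTwo σ α i y) y
      (EuclideanSpace.single i 1) := by
  obtain ⟨C, hC⟩ := exists_gaussianPartial_le (n := n) hσ i
  obtain ⟨C', hC'⟩ := exists_gaussianPartialFDeriv_le (n := n) hσ i
  have e : gaussianPartialTwo σ i =
      fun z => gaussianPartialFDeriv σ i z (EuclideanSpace.single i 1) :=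
    funext fun z => (gaussianPartialFDeriv_single σ i z).symm
  unfold gaussianSmoothingPartialTwo
  rw [e]
  exact hasLineDerivAt_kernelSmoothing (hasFDerivAt_gaussianPartial i)
    (continuous_gaussianPartialFDeriv σ i) hC hC' y (EuclideanSpace.single i 1)

theorem continuous_gaussianSmoothing [IsFiniteMeasure α] (hσ : 0 < σ) :
    Continuous (gaussianSmoothing σ α) :=
  continuous_iff_continuousAt.2 fun y => (hasFDerivAt_gaussianSmoothing hσ y).continuousAt

theorem continuous_gaussianSmoothingPartial [IsFiniteMeasure α] (hσ : 0 < σ) (i : Fin n) :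
    Continuous (gaussianSmoothingPartial σ α i) := by
  obtain ⟨C, hC⟩ := exists_gaussianPartial_le (n := n) hσ i
  obtain ⟨C', hC'⟩ := exists_gaussianPartialFDeriv_le (n := n) hσ i
  exact continuous_iff_continuousAt.2 fun y => (hasFDerivAt_kernelSmoothing
    (hasFDerivAt_gaussianPartial i) (continuous_gaussianPartialFDeriv σ i) hC hC' y).continuousAt

theorem integrable_gaussianSmoothing [IsFiniteMeasure α] (hσ : 0 < σ) :
    Integrable (gaussianSmoothing σ α) :=
  integrable_kernelSmoothing (continuous_gaussianDensity σ) (integrable_gaussianDensity hσ)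

theorem integrable_gaussianSmoothingPartial [IsFiniteMeasure α] (hσ : 0 < σ) (i : Fin n) :
    Integrable (gaussianSmoothingPartial σ α i) :=
  integrable_kernelSmoothing (continuous_gaussianPartial σ i) (integrable_gaussianPartial hσ i)

theorem integrable_gaussianSmoothingPartialTwo [IsFiniteMeasure α] (hσ : 0 < σ) (i : Fin n) :
    Integrable (gaussianSmoothingPartialTwo σ α i) :=
  integrable_kernelSmoothing (continuous_gaussianPartialTwo σ i)
    (integrable_gaussianPartialTwo hσ i)

/-- The Fisher information of a Gaussian smoothing is finite. -/
theorem integrable_sq_gaussianSmoothingPartial_div [IsFiniteMeasure α] [NeZero α] (hσ : 0 < σ)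
    (i : Fin n) :
    Integrable (fun y => gaussianSmoothingPartial σ α i y ^ 2 / gaussianSmoothing σ α y) := by
  have hc := continuous_gaussianDensity (n := n) σ
  have hk : Continuous fun z : EuclideanSpace ℝ (Fin n) => (z i) ^ 2 * gaussianDensity σ z := by
    fun_prop
  have hI := integrable_kernelSmoothing (α := α) hk (integrable_sq_mul_gaussianDensity hσ i)
  refine (hI.const_mul (1 / σ ^ 4)).mono' ?_ (Filter.Eventually.of_forall fun y => ?_)
  · refine Continuous.aestronglyMeasurable (Continuous.div
      ((continuous_gaussianSmoothingPartial hσ i).pow 2) (continuous_gaussianSmoothing hσ)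
      fun y => (gaussianSmoothing_pos hσ y).ne')
  have hpos := gaussianSmoothing_pos (α := α) hσ y
  rw [Real.norm_of_nonneg (by positivity)]
  obtain ⟨C, hC0, hC⟩ := exists_one_add_norm_sq_mul_gaussianDensity_le (n := n) hσ
  have i0 : Integrable (fun x => gaussianDensity σ (y - x)) α :=
    integrable_gaussianDensity_sub hσ y
  have i1 : Integrable (fun x => gaussianPartial σ i (y - x)) α := by
    obtain ⟨C, hC⟩ := exists_gaussianPartial_le (n := n) hσ i
    exact integrable_kernel_sub (continuous_gaussianPartial σ i) hC y
  have i2 : Integrable (fun x => ((y - x) i) ^ 2 * gaussianDensity σ (y - x)) α := by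
    refine integrable_kernel_sub (k := fun z => (z i) ^ 2 * gaussianDensity σ z) hk (C := C)
      (fun z => ?_) y
    have h := gaussianDensity_nonneg σ z
    rw [abs_of_nonneg (by positivity)]
    refine le_trans ?_ (hC z)
    gcongr
    linarith [sq_apply_le_norm_sq z i]
  set u := gaussianSmoothing σ α y with hu
  set v := gaussianSmoothingPartial σ α i y with hv
  -- Cauchy–Schwarz, v² ≤ u ∫ (zᵢ/σ²)² G_σ with z = y − x, from the nonnegative square (zᵢ/σ² + t)²
  -- G_σ at the optimal t = v/u. The sign is plus because ∂ᵢG_σ = −(zᵢ/σ²)G_σ.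
  have key : 0 ≤ ∫ x, (1 / σ ^ 4 * (((y - x) i) ^ 2 * gaussianDensity σ (y - x))
      - 2 * (v / u) * gaussianPartial σ i (y - x)
      + (v / u) ^ 2 * gaussianDensity σ (y - x)) ∂α := by
    refine integral_nonneg fun x => ?_
    have h := gaussianDensity_nonneg σ (y - x)
    have : (1 / σ ^ 4 * (((y - x) i) ^ 2 * gaussianDensity σ (y - x))
      - 2 * (v / u) * gaussianPartial σ i (y - x)
      + (v / u) ^ 2 * gaussianDensity σ (y - x)) =
      ((y - x) i / σ ^ 2 + v / u) ^ 2 * gaussianDensity σ (y - x) := by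
      rw [gaussianPartial]
      field_simp
      ring
    simp only [Pi.zero_apply]
    rw [this]
    positivity
  have i3 : Integrable (fun x => 1 / σ ^ 4 * (((y - x) i) ^ 2 * gaussianDensity σ (y - x))
      - 2 * (v / u) * gaussianPartial σ i (y - x)) α := (i2.const_mul _).sub (i1.const_mul _)
  rw [integral_add i3 (i0.const_mul _), integral_sub (i2.const_mul _) (i1.const_mul _),
    integral_const_mul, integral_const_mul, integral_const_mul] at key
  have e0 : ∫ x, gaussianDensity σ (y - x) ∂α = u := rfl
  have e1 : ∫ x, gaussianPartial σ i (y - x) ∂α = v := rfl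
  rw [e0, e1] at key
  have e2 : v ^ 2 / u = 2 * (v / u) * v - (v / u) ^ 2 * u := by field_simp; ring
  rw [e2]
  simp only [kernelSmoothing]
  linarith

/-- Gaussian envelope of the smoothings with standard deviation in `[a, b]`. -/
noncomputable def gaussianEnvelope (b : ℝ) (z : EuclideanSpace ℝ (Fin n)) : ℝ :=
  Real.exp (-(1 / (4 * b ^ 2)) * ‖z‖ ^ 2)

theorem continuous_gaussianEnvelope (b : ℝ) :
    Continuous (gaussianEnvelope b : EuclideanSpace ℝ (Fin n) → ℝ) := by
  unfold gaussianEnvelope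
  fun_prop

theorem integrable_gaussianEnvelope {b : ℝ} (hb : 0 < b) :
    Integrable (gaussianEnvelope b : EuclideanSpace ℝ (Fin n) → ℝ) :=
  integrable_exp_neg_mul_norm_sq (by positivity)

theorem abs_gaussianEnvelope_le_one (b : ℝ) (z : EuclideanSpace ℝ (Fin n)) :
    |gaussianEnvelope b z| ≤ 1 := by
  rw [gaussianEnvelope, abs_of_pos (Real.exp_pos _)]
  refine Real.exp_le_one_iff.2 ?_
  have : 0 ≤ 1 / (4 * b ^ 2) * ‖z‖ ^ 2 := by positivity
  linarith

/-- The bound is uniform in s, as differentiation under the integral sign requires; the constant is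
worst at s = a, the exponential at s = b. -/
theorem exists_abs_deriv_gaussianDensity_le {a b : ℝ} (ha : 0 < a) :
    ∃ C, 0 ≤ C ∧ ∀ s ∈ Set.Icc a b, ∀ z : EuclideanSpace ℝ (Fin n),
      |s * ∑ i, gaussianPartialTwo s i z| ≤ C * gaussianEnvelope b z := by
  refine ⟨|b| * (n * ((1 / a ^ 4 + 1 / a ^ 2) *
    ((2 * Real.pi * a ^ 2) ^ (-(n : ℝ) / 2) * (1 + 4 * b ^ 2)))), by positivity,
    fun s hs z => ?_⟩
  have hs0 : 0 < s := ha.trans_le hs.1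
  rw [abs_mul, mul_assoc]
  refine mul_le_mul ?_ ?_ (abs_nonneg _) (abs_nonneg _)
  · rw [abs_of_pos hs0]
    exact hs.2.trans (le_abs_self b)
  · refine (Finset.abs_sum_le_sum_abs _ _).trans ?_
    have : ∀ i ∈ Finset.univ, |gaussianPartialTwo s i z| ≤ (1 / a ^ 4 + 1 / a ^ 2) *
        ((2 * Real.pi * a ^ 2) ^ (-(n : ℝ) / 2) * (1 + 4 * b ^ 2)) * gaussianEnvelope b z := by
      intro i _
      refine (abs_gaussianPartialTwo_le s i z).trans ?_
      rw [mul_assoc]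
      refine mul_le_mul ?_ (one_add_norm_sq_mul_gaussianDensity_le ha hs.1 hs.2 z)
        (mul_nonneg (by positivity) (gaussianDensity_nonneg _ _)) (by positivity)
      have := hs.1
      gcongr
    refine (Finset.sum_le_sum this).trans ?_
    simp only [Finset.sum_const, Finset.card_univ, Fintype.card_fin, nsmul_eq_mul]
    rw [← mul_assoc]

/-- The heat equation for Gaussian smoothings, in terms of the standard deviation. -/
theorem hasDerivAt_gaussianSmoothing [IsFiniteMeasure α] (hσ : 0 < σ)
    (y : EuclideanSpace ℝ (Fin n)) :
    HasDerivAt (fun s => gaussianSmoothing s α y)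
      (σ * ∑ i, gaussianSmoothingPartialTwo σ α i y) σ := by
  obtain ⟨C, hC0, hC⟩ := exists_abs_deriv_gaussianDensity_le (n := n) (b := 2 * σ) (half_pos hσ)
  have hmem : Set.Icc (σ / 2) (2 * σ) ∈ nhds σ := Icc_mem_nhds (by linarith) (by linarith)
  have h := hasDerivAt_integral_of_dominated_loc_of_deriv_le (μ := α) (x₀ := σ)
    (F := fun s x => gaussianDensity s (y - x))
    (F' := fun s x => s * ∑ i, gaussianPartialTwo s i (y - x)) (bound := fun _ => C) hmem
    (Filter.Eventually.of_forall fun s => ?_) (integrable_gaussianDensity_sub hσ y) ?_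
    (Filter.Eventually.of_forall fun x s hs => ?_) (integrable_const C)
    (Filter.Eventually.of_forall fun x s hs => ?_)
  · convert! h.2 using 1
    rw [integral_const_mul, integral_finsetSum]
    · rfl
    · intro i _
      obtain ⟨C, hC⟩ := exists_gaussianPartialTwo_le (n := n) hσ i
      exact integrable_kernel_sub (continuous_gaussianPartialTwo σ i) hC y
  · have := continuous_gaussianDensity (n := n) s
    exact Continuous.aestronglyMeasurable (by fun_prop)
  · have := fun i => continuous_gaussianPartialTwo (n := n) σ i
    exact Continuous.aestronglyMeasurable (by fun_prop)
  · refine (hC s hs (y - x)).trans ?_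
    exact mul_le_of_le_one_right hC0
      ((le_abs_self _).trans (abs_gaussianEnvelope_le_one (2 * σ) (y - x)))
  · have hs0 : 0 < s := by linarith [hs.1]
    exact hasDerivAt_gaussianDensity hs0 (y - x)

/-- The majorant does not depend on s and is integrable in y, so the entropy integral over y can be
differentiated in σ. -/
theorem exists_abs_deriv_gaussianSmoothing_le [IsFiniteMeasure α] {a b : ℝ} (ha : 0 < a) :
    ∃ C, 0 ≤ C ∧ ∀ s ∈ Set.Icc a b, ∀ y : EuclideanSpace ℝ (Fin n),
      |s * ∑ i, gaussianSmoothingPartialTwo s α i y| ≤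
        C * kernelSmoothing (gaussianEnvelope b) α y := by
  obtain ⟨C, hC0, hC⟩ := exists_abs_deriv_gaussianDensity_le (n := n) (b := b) ha
  refine ⟨C, hC0, fun s hs y => ?_⟩
  have hs0 : 0 < s := ha.trans_le hs.1
  have : s * ∑ i, gaussianSmoothingPartialTwo s α i y =
      ∫ x, s * ∑ i, gaussianPartialTwo s i (y - x) ∂α := by
    rw [integral_const_mul, integral_finsetSum]
    · rfl
    · intro i _
      obtain ⟨C, hC⟩ := exists_gaussianPartialTwo_le (n := n) hs0 i
      exact integrable_kernel_sub (continuous_gaussianPartialTwo s i) hC y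
  rw [this, kernelSmoothing, ← integral_const_mul, ← Real.norm_eq_abs]
  refine norm_integral_le_of_norm_le (Integrable.const_mul ?_ C)
    (Filter.Eventually.of_forall fun x => hC s hs (y - x))
  exact integrable_kernel_sub (continuous_gaussianEnvelope b) (abs_gaussianEnvelope_le_one b) y

/-- Smoothing is linear and positive in the measure, so a comparison of measures becomes a pointwise
one at every noise level. -/
theorem gaussianSmoothing_le_mul [IsFiniteMeasure α] {β : Measure (EuclideanSpace ℝ (Fin n))}
    [IsFiniteMeasure β] {c : ℝ} (hc : 0 ≤ c) (h : α ≤ ENNReal.ofReal c • β) (hσ : 0 < σ)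
    (y : EuclideanSpace ℝ (Fin n)) :
    gaussianSmoothing σ α y ≤ c * gaussianSmoothing σ β y := by
  have h1 : ∫ x, gaussianDensity σ (y - x) ∂α ≤
      ∫ x, gaussianDensity σ (y - x) ∂(ENNReal.ofReal c • β) :=
    integral_mono_measure h (Filter.Eventually.of_forall fun x => gaussianDensity_nonneg _ _)
      ((integrable_gaussianDensity_sub hσ y).smul_measure ENNReal.ofReal_ne_top)
  rwa [integral_smul_measure, ENNReal.toReal_ofReal hc] at h1

end GaussianSmoothing

/-! ### Dissipation of the relative entropy along the heat flow -/

section Dissipation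

variable {n : ℕ} {σ c : ℝ} {α β : Measure (EuclideanSpace ℝ (Fin n))}

/-- Here u, v stand for the smoothings and a, b for their partial derivatives. The cross term ab/v
is split by the arithmetic-geometric inequality, and u ≤ cv turns a²/v into c·a²/u; what remains are
the two integrable Fisher terms. -/
theorem abs_dissipation_left_le {u v a b c : ℝ} (hu : 0 < u) (hv : 0 < v) (hc : 0 ≤ c)
    (huv : u ≤ c * v) :
    |(a / u - b / v) * a| ≤ (1 + c) * (a ^ 2 / u + b ^ 2 / v) := by
  have h1 : a ^ 2 / v ≤ c * (a ^ 2 / u) := by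
    rw [← mul_div_assoc, div_le_div_iff₀ hv hu]
    nlinarith [sq_nonneg a]
  have h2 : 2 * |a * b / v| ≤ a ^ 2 / v + b ^ 2 / v := by
    rw [abs_div, abs_of_pos hv, ← add_div, ← mul_div_assoc, abs_mul]
    gcongr
    nlinarith [sq_nonneg (|a| - |b|), sq_abs a, sq_abs b]
  have h3 : (a / u - b / v) * a = a ^ 2 / u - a * b / v := by ring
  have hA : 0 ≤ a ^ 2 / u := by positivity
  have hB : 0 ≤ b ^ 2 / v := by positivity
  have hcA := mul_nonneg hc hA
  have hcB := mul_nonneg hc hB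
  rw [h3]
  refine (abs_sub _ _).trans ?_
  rw [abs_of_nonneg hA]
  nlinarith

/-- Same splitting; in addition u/v ≤ c controls the term (u/v)·b²/v. -/
theorem abs_dissipation_right_le {u v a b c : ℝ} (hu : 0 < u) (hv : 0 < v) (hc : 0 ≤ c)
    (huv : u ≤ c * v) :
    |((a * v - u * b) / v ^ 2) * b| ≤ (1 + c) * (a ^ 2 / u + b ^ 2 / v) := by
  have h1 : a ^ 2 / v ≤ c * (a ^ 2 / u) := by
    rw [← mul_div_assoc, div_le_div_iff₀ hv hu]
    nlinarith [sq_nonneg a]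
  have h2 : 2 * |a * b / v| ≤ a ^ 2 / v + b ^ 2 / v := by
    rw [abs_div, abs_of_pos hv, ← add_div, ← mul_div_assoc, abs_mul]
    gcongr
    nlinarith [sq_nonneg (|a| - |b|), sq_abs a, sq_abs b]
  have h3 : ((a * v - u * b) / v ^ 2) * b = a * b / v - u / v * (b ^ 2 / v) := by
    field_simp
  have h4 : u / v ≤ c := by rwa [div_le_iff₀ hv]
  have hA : 0 ≤ a ^ 2 / u := by positivity
  have hB : 0 ≤ b ^ 2 / v := by positivity
  have hcA := mul_nonneg hc hA
  have h5 := mul_le_mul_of_nonneg_right h4 hB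
  rw [h3]
  refine (abs_sub _ _).trans ?_
  rw [abs_of_nonneg (by positivity : 0 ≤ u / v * (b ^ 2 / v))]
  nlinarith

theorem abs_log_div_le {u v c : ℝ} (hu : 0 < u) (hv : 0 < v) (huv : u ≤ c * v)
    (hvu : v ≤ c * u) : |Real.log (u / v)| ≤ Real.log c := by
  have h1 : u / v ≤ c := by rwa [div_le_iff₀ hv]
  have h2 : v / u ≤ c := by rwa [div_le_iff₀ hu]
  rw [abs_le]
  constructor
  · rw [neg_le, ← Real.log_inv, inv_div]
    exact Real.log_le_log (by positivity) h2
  · exact Real.log_le_log (by positivity) h1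

/-- Two measures, each dominated by `c` times the other. -/
structure MutuallyBounded (c : ℝ) (α β : Measure (EuclideanSpace ℝ (Fin n))) : Prop where
  pos : 0 < c
  left : α ≤ ENNReal.ofReal c • β
  right : β ≤ ENNReal.ofReal c • α

/-- The Fisher information density of `G_σ * α` relative to `G_σ * β` in the direction `i`. -/
noncomputable def fisherDensity (σ : ℝ) (α β : Measure (EuclideanSpace ℝ (Fin n))) (i : Fin n)
    (y : EuclideanSpace ℝ (Fin n)) : ℝ :=
  gaussianSmoothing σ α y * (gaussianSmoothingPartial σ α i y / gaussianSmoothing σ α y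
    - gaussianSmoothingPartial σ β i y / gaussianSmoothing σ β y) ^ 2

variable [IsFiniteMeasure α] [IsFiniteMeasure β] [NeZero α] [NeZero β]

/-- The integrand is ∂ᵢ(log(u/v) + 1)·∂ᵢu, one of the two products produced by integrating by parts;
the next lemma treats the other, ∂ᵢ(u/v)·∂ᵢv. -/
theorem integrable_dissipation_left (h : MutuallyBounded c α β) (hσ : 0 < σ) (i : Fin n) :
    Integrable (fun y => (gaussianSmoothingPartial σ α i y / gaussianSmoothing σ α y
      - gaussianSmoothingPartial σ β i y / gaussianSmoothing σ β y)
        * gaussianSmoothingPartial σ α i y) := by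
  refine (((integrable_sq_gaussianSmoothingPartial_div (α := α) hσ i).add
    (integrable_sq_gaussianSmoothingPartial_div (α := β) hσ i)).const_mul (1 + c)).mono' ?_
    (Filter.Eventually.of_forall fun y => ?_)
  · have h1 := continuous_gaussianSmoothing (α := α) hσ
    have h2 := continuous_gaussianSmoothing (α := β) hσ
    have h3 := continuous_gaussianSmoothingPartial (α := α) hσ i
    have h4 := continuous_gaussianSmoothingPartial (α := β) hσ i
    have h5 := fun y => (gaussianSmoothing_pos (α := α) hσ y).ne'
    have h6 := fun y => (gaussianSmoothing_pos (α := β) hσ y).ne'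
    exact (((h3.div h1 h5).sub (h4.div h2 h6)).mul h3).aestronglyMeasurable
  · exact abs_dissipation_left_le (gaussianSmoothing_pos hσ y) (gaussianSmoothing_pos hσ y)
      h.pos.le (gaussianSmoothing_le_mul h.pos.le h.left hσ y)

theorem integrable_dissipation_right (h : MutuallyBounded c α β) (hσ : 0 < σ) (i : Fin n) :
    Integrable (fun y => ((gaussianSmoothingPartial σ α i y * gaussianSmoothing σ β y
      - gaussianSmoothing σ α y * gaussianSmoothingPartial σ β i y) / gaussianSmoothing σ β y ^ 2)
        * gaussianSmoothingPartial σ β i y) := by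
  refine (((integrable_sq_gaussianSmoothingPartial_div (α := α) hσ i).add
    (integrable_sq_gaussianSmoothingPartial_div (α := β) hσ i)).const_mul (1 + c)).mono' ?_
    (Filter.Eventually.of_forall fun y => ?_)
  · have h1 := continuous_gaussianSmoothing (α := α) hσ
    have h2 := continuous_gaussianSmoothing (α := β) hσ
    have h3 := continuous_gaussianSmoothingPartial (α := α) hσ i
    have h4 := continuous_gaussianSmoothingPartial (α := β) hσ i
    have h6 := fun y => pow_ne_zero 2 (gaussianSmoothing_pos (α := β) hσ y).ne'
    exact ((((h3.mul h2).sub (h1.mul h4)).div (h2.pow 2) h6).mul h4).aestronglyMeasurable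
  · exact abs_dissipation_right_le (gaussianSmoothing_pos hσ y) (gaussianSmoothing_pos hσ y)
      h.pos.le (gaussianSmoothing_le_mul h.pos.le h.left hσ y)

/-- The pointwise identity u(∂ᵢ log(u/v))² = ∂ᵢ log(u/v)·∂ᵢu − ∂ᵢ(u/v)·∂ᵢv, which reassembles the
two products into the Fisher information. -/
theorem fisherDensity_eq (hσ : 0 < σ) (i : Fin n) (y : EuclideanSpace ℝ (Fin n)) :
    fisherDensity σ α β i y =
      (gaussianSmoothingPartial σ α i y / gaussianSmoothing σ α y
      - gaussianSmoothingPartial σ β i y / gaussianSmoothing σ β y)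
        * gaussianSmoothingPartial σ α i y
      - ((gaussianSmoothingPartial σ α i y * gaussianSmoothing σ β y
      - gaussianSmoothing σ α y * gaussianSmoothingPartial σ β i y) / gaussianSmoothing σ β y ^ 2)
        * gaussianSmoothingPartial σ β i y := by
  have h1 := gaussianSmoothing_pos (α := α) hσ y
  have h2 := gaussianSmoothing_pos (α := β) hσ y
  rw [fisherDensity]
  field_simp

theorem integrable_fisherDensity (h : MutuallyBounded c α β) (hσ : 0 < σ) (i : Fin n) :
    Integrable (fisherDensity σ α β i) :=
  ((integrable_dissipation_left h hσ i).sub (integrable_dissipation_right h hσ i)).congr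
    (Filter.Eventually.of_forall fun y => (fisherDensity_eq hσ i y).symm)

theorem hasLineDerivAt_log_div (hσ : 0 < σ) (i : Fin n) (y : EuclideanSpace ℝ (Fin n)) :
    HasLineDerivAt ℝ
      (fun y => Real.log (gaussianSmoothing σ α y / gaussianSmoothing σ β y) + 1)
      (gaussianSmoothingPartial σ α i y / gaussianSmoothing σ α y
      - gaussianSmoothingPartial σ β i y / gaussianSmoothing σ β y) y
      (EuclideanSpace.single i 1) := by
  have h1 := gaussianSmoothing_pos (α := α) hσ y
  have h2 := gaussianSmoothing_pos (α := β) hσ y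
  have d1 : HasDerivAt _ _ _ := hasLineDerivAt_gaussianSmoothing (α := α) hσ i y
  have d2 : HasDerivAt _ _ _ := hasLineDerivAt_gaussianSmoothing (α := β) hσ i y
  have d3 := ((d1.div d2 (by simpa using h2.ne')).log (by
    simpa using ⟨h1.ne', h2.ne'⟩)).add_const 1
  change HasDerivAt _ _ _
  convert! d3 using 1
  simp only [Pi.div_apply, zero_smul, add_zero]
  field_simp

theorem hasLineDerivAt_div (hσ : 0 < σ) (i : Fin n) (y : EuclideanSpace ℝ (Fin n)) :
    HasLineDerivAt ℝ
      (fun y => gaussianSmoothing σ α y / gaussianSmoothing σ β y)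
      ((gaussianSmoothingPartial σ α i y * gaussianSmoothing σ β y
      - gaussianSmoothing σ α y * gaussianSmoothingPartial σ β i y) / gaussianSmoothing σ β y ^ 2) y
      (EuclideanSpace.single i 1) := by
  have h2 := gaussianSmoothing_pos (α := β) hσ y
  have d1 : HasDerivAt _ _ _ := hasLineDerivAt_gaussianSmoothing (α := α) hσ i y
  have d2 : HasDerivAt _ _ _ := hasLineDerivAt_gaussianSmoothing (α := β) hσ i y
  have d3 := d1.div d2 (by simpa using h2.ne')
  change HasDerivAt _ _ _
  convert! d3 using 1
  simp only [zero_smul, add_zero]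

theorem abs_log_gaussianSmoothing_div_le (h : MutuallyBounded c α β) (hσ : 0 < σ)
    (y : EuclideanSpace ℝ (Fin n)) :
    |Real.log (gaussianSmoothing σ α y / gaussianSmoothing σ β y)| ≤ Real.log c :=
  abs_log_div_le (gaussianSmoothing_pos hσ y) (gaussianSmoothing_pos hσ y)
    (gaussianSmoothing_le_mul h.pos.le h.left hσ y)
    (gaussianSmoothing_le_mul h.pos.le h.right hσ y)

theorem abs_gaussianSmoothing_div_le (h : MutuallyBounded c α β) (hσ : 0 < σ)
    (y : EuclideanSpace ℝ (Fin n)) :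
    |gaussianSmoothing σ α y / gaussianSmoothing σ β y| ≤ c := by
  have h1 := gaussianSmoothing_pos (α := α) hσ y
  have h2 := gaussianSmoothing_pos (α := β) hσ y
  rw [abs_of_pos (by positivity), div_le_iff₀ h2]
  exact gaussianSmoothing_le_mul h.pos.le h.left hσ y

theorem continuous_gaussianSmoothing_div (hσ : 0 < σ) :
    Continuous fun y => gaussianSmoothing σ α y / gaussianSmoothing σ β y :=
  (continuous_gaussianSmoothing hσ).div (continuous_gaussianSmoothing hσ)
    fun y => (gaussianSmoothing_pos hσ y).ne'

theorem continuous_log_gaussianSmoothing_div (hσ : 0 < σ) :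
    Continuous fun y => Real.log (gaussianSmoothing σ α y / gaussianSmoothing σ β y) :=
  (continuous_gaussianSmoothing_div hσ).log fun y =>
    (div_pos (gaussianSmoothing_pos hσ y) (gaussianSmoothing_pos hσ y)).ne'

theorem integrable_log_mul (h : MutuallyBounded c α β) (hσ : 0 < σ)
    {w : EuclideanSpace ℝ (Fin n) → ℝ} (hw : Integrable w) :
    Integrable fun y =>
      (Real.log (gaussianSmoothing σ α y / gaussianSmoothing σ β y) + 1) * w y := by
  refine hw.bdd_mul (c := Real.log c + 1)
    ((continuous_log_gaussianSmoothing_div hσ).add continuous_const).aestronglyMeasurable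
    (Filter.Eventually.of_forall fun y => ?_)
  refine (norm_add_le _ _).trans ?_
  simpa using abs_log_gaussianSmoothing_div_le h hσ y

theorem integrable_div_mul (h : MutuallyBounded c α β) (hσ : 0 < σ)
    {w : EuclideanSpace ℝ (Fin n) → ℝ} (hw : Integrable w) :
    Integrable fun y => gaussianSmoothing σ α y / gaussianSmoothing σ β y * w y :=
  hw.bdd_mul (c := c) (continuous_gaussianSmoothing_div hσ).aestronglyMeasurable
    (Filter.Eventually.of_forall fun y => abs_gaussianSmoothing_div_le h hσ y)

/-- Integration by parts for the dissipation of relative entropy in the direction `i`. -/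
theorem integral_dissipation (h : MutuallyBounded c α β) (hσ : 0 < σ) (i : Fin n) :
    ∫ y, ((Real.log (gaussianSmoothing σ α y / gaussianSmoothing σ β y) + 1)
        * gaussianSmoothingPartialTwo σ α i y
      - gaussianSmoothing σ α y / gaussianSmoothing σ β y * gaussianSmoothingPartialTwo σ β i y) =
      - ∫ y, fisherDensity σ α β i y := by
  -- There are no boundary terms, since both products of a function with a derivative, and the
  -- product of the functions themselves, are integrable.
  have e1 := integral_bilinear_hasLineDerivAt_right_eq_neg_left_of_integrable
    (μ := (volume : Measure (EuclideanSpace ℝ (Fin n)))) (B := ContinuousLinearMap.mul ℝ ℝ)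
    (v := EuclideanSpace.single i 1)
    (integrable_dissipation_left h hσ i)
    (integrable_log_mul h hσ (integrable_gaussianSmoothingPartialTwo hσ i))
    (integrable_log_mul h hσ (integrable_gaussianSmoothingPartial hσ i))
    (fun y _ => hasLineDerivAt_log_div hσ i y)
    (fun y _ => hasLineDerivAt_gaussianSmoothingPartial hσ i y)
  have e2 := integral_bilinear_hasLineDerivAt_right_eq_neg_left_of_integrable
    (μ := (volume : Measure (EuclideanSpace ℝ (Fin n)))) (B := ContinuousLinearMap.mul ℝ ℝ)
    (v := EuclideanSpace.single i 1)
    (integrable_dissipation_right h hσ i)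
    (integrable_div_mul h hσ (integrable_gaussianSmoothingPartialTwo hσ i))
    (integrable_div_mul h hσ (integrable_gaussianSmoothingPartial hσ i))
    (fun y _ => hasLineDerivAt_div hσ i y)
    (fun y _ => hasLineDerivAt_gaussianSmoothingPartial hσ i y)
  simp only [ContinuousLinearMap.mul_apply'] at e1 e2
  simp_rw [fisherDensity_eq hσ]
  rw [integral_sub (integrable_log_mul h hσ (integrable_gaussianSmoothingPartialTwo hσ i))
    (integrable_div_mul h hσ (integrable_gaussianSmoothingPartialTwo hσ i)), e1, e2,
    integral_sub (integrable_dissipation_left h hσ i) (integrable_dissipation_right h hσ i)]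
  ring

/-- The relative entropy `∫ u log (u / v)` of the smoothings `u = G_σ * α` and `v = G_σ * β`. -/
noncomputable def smoothedEntropy (α β : Measure (EuclideanSpace ℝ (Fin n))) (σ : ℝ) : ℝ :=
  ∫ y, gaussianSmoothing σ α y * Real.log (gaussianSmoothing σ α y / gaussianSmoothing σ β y)

theorem integrable_smoothedEntropy (h : MutuallyBounded c α β) (hσ : 0 < σ) :
    Integrable fun y => gaussianSmoothing σ α y *
      Real.log (gaussianSmoothing σ α y / gaussianSmoothing σ β y) :=
  (integrable_gaussianSmoothing hσ).mul_bdd (c := Real.log c)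
    (continuous_log_gaussianSmoothing_div hσ).aestronglyMeasurable
    (Filter.Eventually.of_forall fun y => abs_log_gaussianSmoothing_div_le h hσ y)

/-- The gradient of (a, b) ↦ a log(a/b) is (log(a/b) + 1, −a/b); this is the origin of the two
weights in the dissipation. -/
theorem hasDerivAt_mul_log_div {f g : ℝ → ℝ} {f' g' x : ℝ} (hf : HasDerivAt f f' x)
    (hg : HasDerivAt g g' x) (hf0 : 0 < f x) (hg0 : 0 < g x) :
    HasDerivAt (fun s => f s * Real.log (f s / g s))
      ((Real.log (f x / g x) + 1) * f' - f x / g x * g') x := by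
  have h := hf.mul ((hf.div hg hg0.ne').log (div_pos hf0 hg0).ne')
  convert! h using 1
  simp only [Pi.div_apply]
  field_simp
  ring

/-- De Bruijn's identity for the relative entropy of two Gaussian smoothings. -/
theorem hasDerivAt_smoothedEntropy (h : MutuallyBounded c α β) (hσ : 0 < σ) :
    HasDerivAt (smoothedEntropy α β) (-(σ * ∑ i, ∫ y, fisherDensity σ α β i y)) σ := by
  obtain ⟨C, hC0, hC⟩ := exists_abs_deriv_gaussianSmoothing_le (α := α) (b := 2 * σ) (half_pos hσ)
  obtain ⟨D, hD0, hD⟩ := exists_abs_deriv_gaussianSmoothing_le (α := β) (b := 2 * σ) (half_pos hσ)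
  have hmem : Set.Icc (σ / 2) (2 * σ) ∈ nhds σ := Icc_mem_nhds (by linarith) (by linarith)
  have hE (γ : Measure (EuclideanSpace ℝ (Fin n))) [IsFiniteMeasure γ] :=
    integrable_kernelSmoothing (α := γ) (continuous_gaussianEnvelope (n := n) (2 * σ))
      (integrable_gaussianEnvelope (by positivity))
  have hi1 := fun i => integrable_gaussianSmoothingPartialTwo (α := α) hσ i
  have hi2 := fun i => integrable_gaussianSmoothingPartialTwo (α := β) hσ i
  have hmeas : Integrable fun y =>
      (Real.log (gaussianSmoothing σ α y / gaussianSmoothing σ β y) + 1)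
          * (σ * ∑ i, gaussianSmoothingPartialTwo σ α i y)
        - gaussianSmoothing σ α y / gaussianSmoothing σ β y
          * (σ * ∑ i, gaussianSmoothingPartialTwo σ β i y) :=
    (integrable_log_mul h hσ ((integrable_finsetSum _ fun i _ => hi1 i).const_mul σ)).sub
      (integrable_div_mul h hσ ((integrable_finsetSum _ fun i _ => hi2 i).const_mul σ))
  -- Mutual boundedness keeps the weights log(u/v) + 1 and u/v below log c + 1 and c for every s, so
  -- the envelopes for ∂_s u and ∂_s v give an integrable majorant.
  have key := hasDerivAt_integral_of_dominated_loc_of_deriv_le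
    (μ := (volume : Measure (EuclideanSpace ℝ (Fin n)))) (x₀ := σ)
    (F := fun s y => gaussianSmoothing s α y *
      Real.log (gaussianSmoothing s α y / gaussianSmoothing s β y))
    (F' := fun s y => (Real.log (gaussianSmoothing s α y / gaussianSmoothing s β y) + 1)
          * (s * ∑ i, gaussianSmoothingPartialTwo s α i y)
        - gaussianSmoothing s α y / gaussianSmoothing s β y
          * (s * ∑ i, gaussianSmoothingPartialTwo s β i y))
    (bound := fun y => (Real.log c + 1) * (C * kernelSmoothing (gaussianEnvelope (2 * σ)) α y)
      + c * (D * kernelSmoothing (gaussianEnvelope (2 * σ)) β y)) hmem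
    ?_ (integrable_smoothedEntropy h hσ) hmeas.aestronglyMeasurable
    (Filter.Eventually.of_forall fun y s hs => ?_)
    ((((hE α).const_mul C).const_mul _).add (((hE β).const_mul D).const_mul _))
    (Filter.Eventually.of_forall fun y s hs => ?_)
  · unfold smoothedEntropy
    convert! key.2 using 1
    have e (y : EuclideanSpace ℝ (Fin n)) :
        (Real.log (gaussianSmoothing σ α y / gaussianSmoothing σ β y) + 1)
          * (σ * ∑ i, gaussianSmoothingPartialTwo σ α i y)
        - gaussianSmoothing σ α y / gaussianSmoothing σ β y
          * (σ * ∑ i, gaussianSmoothingPartialTwo σ β i y) =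
        σ * ∑ i, ((Real.log (gaussianSmoothing σ α y / gaussianSmoothing σ β y) + 1)
          * gaussianSmoothingPartialTwo σ α i y
        - gaussianSmoothing σ α y / gaussianSmoothing σ β y
          * gaussianSmoothingPartialTwo σ β i y) := by
      rw [Finset.sum_sub_distrib, ← Finset.mul_sum, ← Finset.mul_sum]
      ring
    simp_rw [e]
    rw [integral_const_mul, integral_finsetSum]
    · simp_rw [integral_dissipation h hσ]
      simp
    · exact fun i _ => (integrable_log_mul h hσ (hi1 i)).sub (integrable_div_mul h hσ (hi2 i))
  · filter_upwards [hmem] with s hs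
    have hs0 : 0 < s := by linarith [hs.1]
    exact (integrable_smoothedEntropy h hs0).aestronglyMeasurable
  · have hs0 : 0 < s := by linarith [hs.1]
    refine (norm_sub_le _ _).trans (add_le_add ?_ ?_)
    · rw [norm_mul]
      refine mul_le_mul ?_ (hC s hs y) (norm_nonneg _) ?_
      · refine (norm_add_le _ _).trans ?_
        simpa using abs_log_gaussianSmoothing_div_le h hs0 y
      · linarith [(abs_nonneg _).trans (abs_log_gaussianSmoothing_div_le h hs0 y)]
    · rw [norm_mul]
      exact mul_le_mul (abs_gaussianSmoothing_div_le h hs0 y) (hD s hs y) (norm_nonneg _) h.pos.le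
  · have hs0 : 0 < s := by linarith [hs.1]
    exact hasDerivAt_mul_log_div (hasDerivAt_gaussianSmoothing hs0 y)
      (hasDerivAt_gaussianSmoothing hs0 y) (gaussianSmoothing_pos hs0 y)
      (gaussianSmoothing_pos hs0 y)

end Dissipation

/-! ### Continuity of translations in `L¹` -/

section Translation

variable {n : ℕ}

/-- The `L¹` modulus of continuity `h ↦ ‖f (· - h) - f‖₁`. -/
noncomputable def translationModulus (f : EuclideanSpace ℝ (Fin n) → ℝ)
    (h : EuclideanSpace ℝ (Fin n)) : ℝ≥0∞ :=
  ∫⁻ y, ‖f (y - h) - f y‖ₑ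

/-- The translation group acts continuously on L¹, and the modulus is a distance between a translate
and `f`. -/
theorem continuous_translationModulus {f : EuclideanSpace ℝ (Fin n) → ℝ} (hf : Integrable f) :
    Continuous (translationModulus f) := by
  have hL := memLp_one_iff_integrable.2 hf
  have key (h : EuclideanSpace ℝ (Fin n)) : translationModulus f h =
      edist (DomAddAct.mk (-h) +ᵥ hL.toLp f) (hL.toLp f) := by
    rw [DomAddAct.mk_vadd_toLp, Lp.edist_toLp_toLp, eLpNorm_one_eq_lintegral_enorm]
    refine lintegral_congr fun y => ?_
    simp only [Pi.sub_apply, vadd_eq_add, neg_add_eq_sub]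
  rw [show translationModulus f = _ from funext key]
  have : Continuous fun h : EuclideanSpace ℝ (Fin n) => DomAddAct.mk (-h) +ᵥ hL.toLp f := by
    have h1 : Continuous fun h : EuclideanSpace ℝ (Fin n) => DomAddAct.mk (-h) :=
      DomAddAct.continuous_mk.comp continuous_neg
    have : Fact ((1 : ℝ≥0∞) ≠ ∞) := ⟨ENNReal.one_ne_top⟩
    exact h1.vadd continuous_const
  exact this.edist continuous_const

theorem translationModulus_zero (f : EuclideanSpace ℝ (Fin n) → ℝ) :
    translationModulus f 0 = 0 := by
  simp [translationModulus]

theorem translationModulus_le {f : EuclideanSpace ℝ (Fin n) → ℝ} (hf : Measurable f)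
    (h : EuclideanSpace ℝ (Fin n)) : translationModulus f h ≤ 2 * ∫⁻ y, ‖f y‖ₑ := by
  calc translationModulus f h ≤ ∫⁻ y, (‖f (y - h)‖ₑ + ‖f y‖ₑ) :=
        lintegral_mono fun y => enorm_sub_le
    _ = 2 * ∫⁻ y, ‖f y‖ₑ := by
        rw [lintegral_add_right _ hf.enorm, lintegral_sub_right_eq_self (fun y => ‖f y‖ₑ) h,
          two_mul]

/-- Serves both ends of the flow: σ → ∞ with `f` the unit Gaussian and r = 1/σ, and σ → 0 with `f`
the density, r = σ and μ the unit Gaussian law. -/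
theorem tendsto_lintegral_translationModulus {f : EuclideanSpace ℝ (Fin n) → ℝ}
    (hm : Measurable f) (hf : Integrable f) {μ : Measure (EuclideanSpace ℝ (Fin n))}
    [IsFiniteMeasure μ] {l : Filter ℝ} [l.IsCountablyGenerated] {r : ℝ → ℝ}
    (hr : Filter.Tendsto r l (nhds 0)) :
    Filter.Tendsto (fun s => ∫⁻ z, translationModulus f (r s • z) ∂μ) l (nhds 0) := by
  have hc := continuous_translationModulus hf
  have h := tendsto_lintegral_filter_of_dominated_convergence (μ := μ) (l := l)
    (F := fun s z => translationModulus f (r s • z)) (f := fun _ => 0)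
    (fun _ => 2 * ∫⁻ y, ‖f y‖ₑ)
    (Filter.Eventually.of_forall fun s => Continuous.measurable (by fun_prop))
    (Filter.Eventually.of_forall fun s => Filter.Eventually.of_forall fun z =>
      translationModulus_le hm _) ?_ (Filter.Eventually.of_forall fun z => ?_)
  · simpa using h
  · rw [lintegral_const]
    exact ENNReal.mul_ne_top (ENNReal.mul_ne_top (by simp) hf.2.ne) (measure_ne_top _ _)
  · have h1 : Filter.Tendsto (fun s => r s • z) l (nhds 0) := by
      simpa using hr.smul_const z
    have h2 := (hc.tendsto 0).comp h1
    rwa [translationModulus_zero] at h2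

theorem measure_eq_smul_map_smul {r : ℝ} (hr : 0 < r) :
    (volume : Measure (EuclideanSpace ℝ (Fin n))) =
      ENNReal.ofReal (r ^ n) • Measure.map (fun x => r • x) volume := by
  rw [Measure.map_addHaar_smul _ hr.ne', smul_smul, ← ENNReal.ofReal_mul (by positivity),
    abs_of_pos (by positivity), finrank_euclideanSpace_fin, mul_inv_cancel₀ (by positivity)]
  simp

/-- The L¹ norm is invariant under mass-preserving dilation, so a shift x of a Gaussian of width σ
is as visible as a shift x/σ at width 1. -/
theorem translationModulus_gaussianDensity {σ : ℝ} (hσ : 0 < σ) (x : EuclideanSpace ℝ (Fin n)) :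
    translationModulus (gaussianDensity σ) x =
      translationModulus (gaussianDensity 1) (σ⁻¹ • x) := by
  have hc := continuous_gaussianDensity (n := n) σ
  unfold translationModulus
  conv_lhs => rw [measure_eq_smul_map_smul (n := n) hσ]
  rw [lintegral_smul_measure, lintegral_map (Continuous.measurable (by fun_prop)) (by fun_prop),
    smul_eq_mul, ← lintegral_const_mul _ (Continuous.measurable (by fun_prop))]
  refine lintegral_congr fun y => ?_
  rw [← gaussianDensity_smul hσ, ← gaussianDensity_smul hσ, smul_sub, smul_smul,
    mul_inv_cancel₀ hσ.ne', one_smul, ← mul_sub, enorm_mul,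
    Real.enorm_of_nonneg (by positivity : 0 ≤ σ ^ n)]

end Translation

/-! ### L¹ limits of Gaussian smoothings for large and for small noise -/

section Limits

variable {n : ℕ} {σ : ℝ} {α : Measure (EuclideanSpace ℝ (Fin n))}

/-- Compares α with a point mass at the origin of the same total mass; the error is an average of
translation errors. -/
theorem lintegral_enorm_gaussianSmoothing_sub_le [IsFiniteMeasure α] (hσ : 0 < σ) :
    ∫⁻ y, ‖gaussianSmoothing σ α y - α.real Set.univ * gaussianDensity σ y‖ₑ ≤
      ∫⁻ x, translationModulus (gaussianDensity 1) (σ⁻¹ • x) ∂α := by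
  have hc := continuous_gaussianDensity (n := n) σ
  have e (y : EuclideanSpace ℝ (Fin n)) :
      gaussianSmoothing σ α y - α.real Set.univ * gaussianDensity σ y =
        ∫ x, (gaussianDensity σ (y - x) - gaussianDensity σ y) ∂α := by
    rw [integral_sub (integrable_gaussianDensity_sub hσ y) (integrable_const _), integral_const,
      smul_eq_mul]
    rfl
  calc ∫⁻ y, ‖gaussianSmoothing σ α y - α.real Set.univ * gaussianDensity σ y‖ₑ
      ≤ ∫⁻ y, ∫⁻ x, ‖gaussianDensity σ (y - x) - gaussianDensity σ y‖ₑ ∂α := by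
        refine lintegral_mono fun y => ?_
        simp only [e]
        exact enorm_integral_le_lintegral_enorm _
    _ = ∫⁻ x, (∫⁻ y, ‖gaussianDensity σ (y - x) - gaussianDensity σ y‖ₑ) ∂α := by
        refine lintegral_lintegral_swap (Continuous.measurable ?_).aemeasurable
        simp only [Function.uncurry_def]
        fun_prop
    _ = _ := lintegral_congr fun x => translationModulus_gaussianDensity hσ x

/-- Any two finite measures of equal mass become close in `L¹` under strong Gaussian smoothing. -/
theorem tendsto_gaussianSmoothing_sub_atTop [IsFiniteMeasure α]
    {β : Measure (EuclideanSpace ℝ (Fin n))} [IsFiniteMeasure β]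
    (h : α.real Set.univ = β.real Set.univ) :
    Filter.Tendsto (fun σ => ∫⁻ y, ‖gaussianSmoothing σ α y - gaussianSmoothing σ β y‖ₑ)
      Filter.atTop (nhds 0) := by
  have hg (γ : Measure (EuclideanSpace ℝ (Fin n))) [IsFiniteMeasure γ] :=
    tendsto_lintegral_translationModulus (μ := γ)
      (continuous_gaussianDensity (n := n) 1).measurable (integrable_gaussianDensity one_pos)
      tendsto_inv_atTop_zero
  have hsum := (hg α).add (hg β)
  rw [add_zero] at hsum
  refine tendsto_of_tendsto_of_tendsto_of_le_of_le' tendsto_const_nhds hsum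
    (Filter.Eventually.of_forall fun _ => zero_le) ?_
  filter_upwards [Filter.eventually_gt_atTop 0] with σ hσ
  refine le_trans ?_ (add_le_add (lintegral_enorm_gaussianSmoothing_sub_le hσ)
    (lintegral_enorm_gaussianSmoothing_sub_le hσ))
  have hm1 := continuous_gaussianSmoothing (α := α) hσ
  have hm2 := continuous_gaussianDensity (n := n) σ
  rw [← lintegral_add_left (Continuous.measurable (by fun_prop))]
  refine lintegral_mono fun y => ?_
  rw [h]
  refine le_trans (le_of_eq ?_) enorm_sub_le
  congr 1
  ring

theorem gaussianSmoothing_densityMeasure {a : EuclideanSpace ℝ (Fin n) → ℝ} (ha : Measurable a)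
    (ha0 : ∀ x, 0 ≤ a x) (σ : ℝ) (y : EuclideanSpace ℝ (Fin n)) :
    gaussianSmoothing σ (densityMeasure a) y = ∫ x, gaussianDensity σ (y - x) * a x := by
  unfold gaussianSmoothing kernelSmoothing densityMeasure
  rw [integral_withDensity_eq_integral_toReal_smul ha.ennreal_ofReal
    (Filter.Eventually.of_forall fun _ => ENNReal.ofReal_lt_top)]
  refine integral_congr_ae (Filter.Eventually.of_forall fun x => ?_)
  simp only [smul_eq_mul, ENNReal.toReal_ofReal (ha0 x)]
  exact mul_comm _ _

/-- The smoothing is a Gaussian average of translates of `a`. Minkowski's inequality bounds the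
error by averaged translation moduli, and w = σz moves the dependence on σ from the averaging law
into the shift. -/
theorem lintegral_enorm_gaussianSmoothing_densityMeasure_sub_le
    {a : EuclideanSpace ℝ (Fin n) → ℝ} (ha : Measurable a)
    (ha0 : ∀ x, 0 ≤ a x) (hi : Integrable a) (hσ : 0 < σ) :
    ∫⁻ y, ‖gaussianSmoothing σ (densityMeasure a) y - a y‖ₑ ≤
      ∫⁻ z, translationModulus a (σ • z)
        ∂(volume.withDensity fun z => ENNReal.ofReal (gaussianDensity 1 z)) := by
  have hc := continuous_gaussianDensity (n := n) 1
  have hcσ := continuous_gaussianDensity (n := n) σ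
  have hmod : Measurable fun z : EuclideanSpace ℝ (Fin n) => translationModulus a (σ • z) := by
    have := continuous_translationModulus hi
    exact Continuous.measurable (by fun_prop)
  have e1 (y : EuclideanSpace ℝ (Fin n)) : gaussianSmoothing σ (densityMeasure a) y =
      ∫ w, gaussianDensity σ w * a (y - w) := by
    rw [gaussianSmoothing_densityMeasure ha ha0]
    have := integral_sub_left_eq_self
      (fun w : EuclideanSpace ℝ (Fin n) => gaussianDensity σ w * a (y - w)) volume y
    rw [← this]
    simp
  have e2 (y : EuclideanSpace ℝ (Fin n)) : gaussianSmoothing σ (densityMeasure a) y - a y =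
      ∫ w, gaussianDensity σ w * (a (y - w) - a y) := by
    have i1 : Integrable fun w => gaussianDensity σ w * a (y - w) := by
      obtain ⟨C, hC⟩ := exists_gaussianDensity_le (n := n) hσ
      exact (hi.comp_sub_left y).bdd_mul hcσ.aestronglyMeasurable
        (Filter.Eventually.of_forall hC)
    have i2 : Integrable fun w : EuclideanSpace ℝ (Fin n) => gaussianDensity σ w * a y :=
      (integrable_gaussianDensity hσ).mul_const _
    simp_rw [mul_sub]
    rw [integral_sub i1 i2, integral_mul_const, integral_gaussianDensity hσ, one_mul, e1]
  calc ∫⁻ y, ‖gaussianSmoothing σ (densityMeasure a) y - a y‖ₑ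
      ≤ ∫⁻ y, ∫⁻ w, ENNReal.ofReal (gaussianDensity σ w) * ‖a (y - w) - a y‖ₑ := by
        refine lintegral_mono fun y => ?_
        simp only [e2]
        refine (enorm_integral_le_lintegral_enorm _).trans (le_of_eq ?_)
        refine lintegral_congr fun w => ?_
        rw [enorm_mul, Real.enorm_of_nonneg (gaussianDensity_nonneg _ _)]
    _ = ∫⁻ w, ∫⁻ y, ENNReal.ofReal (gaussianDensity σ w) * ‖a (y - w) - a y‖ₑ := by
        refine lintegral_lintegral_swap (Measurable.aemeasurable ?_)
        simp only [Function.uncurry_def]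
        fun_prop
    _ = ∫⁻ w, ENNReal.ofReal (gaussianDensity σ w) * translationModulus a w := by
        refine lintegral_congr fun w => ?_
        rw [lintegral_const_mul _ (by fun_prop)]
        rfl
    _ = ∫⁻ z, ENNReal.ofReal (gaussianDensity 1 z) * translationModulus a (σ • z) := by
        have hmod' := (continuous_translationModulus hi).measurable
        conv_lhs => rw [measure_eq_smul_map_smul (n := n) hσ]
        rw [lintegral_smul_measure, lintegral_map (by fun_prop) (by fun_prop),
          smul_eq_mul, ← lintegral_const_mul _ (by fun_prop)]
        refine lintegral_congr fun z => ?_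
        rw [← gaussianDensity_smul hσ, ENNReal.ofReal_mul (by positivity), mul_assoc]
    _ = _ := by
        rw [lintegral_withDensity_eq_lintegral_mul _ (by fun_prop) hmod]
        rfl

/-- Gaussian smoothings of an integrable density converge to it in `L¹`. -/
theorem tendsto_gaussianSmoothing_sub_zero {a : EuclideanSpace ℝ (Fin n) → ℝ} (ha : Measurable a)
    (ha0 : ∀ x, 0 ≤ a x) (hi : Integrable a) :
    Filter.Tendsto (fun σ => ∫⁻ y, ‖gaussianSmoothing σ (densityMeasure a) y - a y‖ₑ)
      (nhdsWithin 0 (Set.Ioi 0)) (nhds 0) := by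
  have : IsFiniteMeasure ((volume : Measure (EuclideanSpace ℝ (Fin n))).withDensity
      fun z => ENNReal.ofReal (gaussianDensity 1 z)) :=
    isFiniteMeasure_withDensity_ofReal (integrable_gaussianDensity one_pos).2
  have h := tendsto_lintegral_translationModulus (μ := ((volume : Measure
    (EuclideanSpace ℝ (Fin n))).withDensity fun z => ENNReal.ofReal (gaussianDensity 1 z)))
    ha hi (l := nhdsWithin (0 : ℝ) (Set.Ioi 0)) (r := fun s => s)
    (Filter.tendsto_id.mono_left nhdsWithin_le_nhds)
  refine tendsto_of_tendsto_of_tendsto_of_le_of_le' tendsto_const_nhds h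
    (Filter.Eventually.of_forall fun _ => zero_le) ?_
  filter_upwards [self_mem_nhdsWithin] with σ hσ
  exact lintegral_enorm_gaussianSmoothing_densityMeasure_sub_le ha ha0 hi hσ

end Limits

/-! ### The entropy identity for comparable densities -/

section EntropyIdentity

variable {n : ℕ} {c : ℝ}

/-- Joint convexity of (a, b) ↦ a log(a/b): the tangent plane at (a, b) lies below the graph at (a',
b'). It reduces to log t ≥ 1 − 1/t. -/
theorem mul_log_div_sub_le {a b a' b' : ℝ} (ha : 0 < a) (hb : 0 < b) (ha' : 0 < a')
    (hb' : 0 < b') :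
    a * Real.log (a / b) - a' * Real.log (a' / b') ≤
      (a - a') * (Real.log (a / b) + 1) - (b - b') * (a / b) := by
  have h1 := Real.one_sub_inv_le_log_of_pos (x := (a' / b') / (a / b)) (by positivity)
  rw [Real.log_div (by positivity) (by positivity)] at h1
  have h2 := mul_le_mul_of_nonneg_left h1 ha'.le
  have h3 : a' * (1 - (a' / b' / (a / b))⁻¹) = a' - b' * (a / b) := by
    field_simp
  have h4 : b * (a / b) = a := by field_simp
  rw [h3] at h2
  linarith

/-- On the cone where the ratio lies in [1/c, c] the gradient is bounded, so convexity gives a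
Lipschitz bound. Zero values need separate cases since densities, unlike smoothings, may vanish;
comparability makes both members of a pair vanish together. -/
theorem mul_log_div_sub_le_of_bounded {a b a' b' c : ℝ} (ha : 0 ≤ a) (ha' : 0 ≤ a')
    (hc : 1 ≤ c) (hb : 0 ≤ b) (hb' : 0 ≤ b') (h1 : a ≤ c * b) (h2 : b ≤ c * a)
    (h1' : a' ≤ c * b') (h2' : b' ≤ c * a') :
    a * Real.log (a / b) - a' * Real.log (a' / b') ≤
      (Real.log c + 1 + c) * (|a - a'| + |b - b'|) := by
  have hlc := Real.log_nonneg hc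
  have hA := abs_nonneg (a - a')
  have hB := abs_nonneg (b - b')
  rcases ha.eq_or_lt with rfl | ha
  · have hb0 : b = 0 := by linarith
    subst hb0
    rcases ha'.eq_or_lt with rfl | ha'
    · simp
      positivity
    have hb'0 : 0 < b' := by nlinarith
    have h := neg_le_of_abs_le (abs_log_div_le ha' hb'0 h1' h2')
    have h4 := mul_le_mul_of_nonneg_left h ha'.le
    have hA' : |0 - a'| = a' := by simp [abs_of_pos ha']
    have hcp : 0 ≤ c := by linarith
    rw [hA', zero_mul]
    nlinarith [mul_nonneg hlc hB, mul_nonneg hcp hB, mul_nonneg hcp ha'.le]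
  have hb0 : 0 < b := by nlinarith
  have hlog := abs_log_div_le ha hb0 h1 h2
  rcases ha'.eq_or_lt with rfl | ha'
  · have hb'0 : b' = 0 := by linarith
    subst hb'0
    have h4 := mul_le_mul_of_nonneg_left (le_of_abs_le hlog) ha.le
    rw [sub_zero, abs_of_pos ha] at *
    simp only [zero_mul, sub_zero]
    nlinarith [mul_nonneg hlc hB]
  have hb'0 : 0 < b' := by nlinarith
  refine (mul_log_div_sub_le ha hb0 ha' hb'0).trans ?_
  have h5 : (a - a') * (Real.log (a / b) + 1) ≤ |a - a'| * (Real.log c + 1) := by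
    refine (le_abs_self _).trans ?_
    rw [abs_mul]
    gcongr
    refine (abs_add_le _ _).trans ?_
    simpa using hlog
  have h6 : -((b - b') * (a / b)) ≤ |b - b'| * c := by
    refine (neg_le_abs _).trans ?_
    rw [abs_mul, abs_of_pos (div_pos ha hb0)]
    gcongr
    rwa [div_le_iff₀ hb0]
  nlinarith [mul_nonneg hlc hB]

/-- This Lipschitz bound turns L¹ convergence of the smoothings into convergence of entropies at
both ends. -/
theorem abs_mul_log_div_sub_le {a b a' b' c : ℝ} (ha : 0 ≤ a) (ha' : 0 ≤ a')
    (hc : 1 ≤ c) (hb : 0 ≤ b) (hb' : 0 ≤ b') (h1 : a ≤ c * b) (h2 : b ≤ c * a)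
    (h1' : a' ≤ c * b') (h2' : b' ≤ c * a') :
    |a * Real.log (a / b) - a' * Real.log (a' / b')| ≤
      (Real.log c + 1 + c) * (|a - a'| + |b - b'|) := by
  rw [abs_le]
  constructor
  · have := mul_log_div_sub_le_of_bounded ha' ha hc hb' hb h1' h2' h1 h2
    rw [abs_sub_comm a', abs_sub_comm b'] at this
    linarith
  · exact mul_log_div_sub_le_of_bounded ha ha' hc hb hb' h1 h2 h1' h2'

variable {α β : Measure (EuclideanSpace ℝ (Fin n))} [IsFiniteMeasure α] [IsFiniteMeasure β]
  [NeZero α] [NeZero β]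

theorem tendsto_smoothedEntropy_atTop (h : MutuallyBounded c α β) (hc : 1 ≤ c)
    (hm : α.real Set.univ = β.real Set.univ) :
    Filter.Tendsto (smoothedEntropy α β) Filter.atTop (nhds 0) := by
  have h0 : Filter.Tendsto (smoothedEntropy α β) Filter.atTop
      (nhds (∫ _ : EuclideanSpace ℝ (Fin n), (0 : ℝ))) := by
    refine tendsto_integral_of_L1 (fun _ => 0) aestronglyMeasurable_const ?_ ?_
    · filter_upwards [Filter.eventually_gt_atTop 0] with σ hσ
      exact integrable_smoothedEntropy h hσ
    have h2 := ENNReal.Tendsto.const_mul (a := ENNReal.ofReal (Real.log c + 1 + c))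
      (tendsto_gaussianSmoothing_sub_atTop hm) (Or.inr ENNReal.ofReal_ne_top)
    rw [mul_zero] at h2
    refine tendsto_of_tendsto_of_tendsto_of_le_of_le' tendsto_const_nhds h2
      (Filter.Eventually.of_forall fun _ => zero_le) ?_
    filter_upwards [Filter.eventually_gt_atTop 0] with σ hσ
    rw [← lintegral_const_mul' _ _ ENNReal.ofReal_ne_top]
    refine lintegral_mono fun y => ?_
    have hu := gaussianSmoothing_pos (α := α) hσ y
    have hv := gaussianSmoothing_pos (α := β) hσ y
    -- The pair (u, v) is compared with (v, v), whose entropy is zero; comparability of v with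
    -- itself is where 1 ≤ c enters.
    have hcv : gaussianSmoothing σ β y ≤ c * gaussianSmoothing σ β y := by nlinarith
    have := abs_mul_log_div_sub_le hu.le hv.le hc hv.le hv.le
      (gaussianSmoothing_le_mul h.pos.le h.left hσ y)
      (gaussianSmoothing_le_mul h.pos.le h.right hσ y) hcv hcv
    rw [div_self hv.ne', Real.log_one, mul_zero, sub_self, abs_zero, add_zero] at this
    rw [← ofReal_norm, ← ofReal_norm, ← ENNReal.ofReal_mul (by
      linarith [Real.log_nonneg hc])]
    exact ENNReal.ofReal_le_ofReal this
  simpa using h0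

theorem densityMeasure_le_smul {a b : EuclideanSpace ℝ (Fin n) → ℝ} (hc : 0 ≤ c)
    (hb : Measurable b) (hab : ∀ x, a x ≤ c * b x) :
    densityMeasure a ≤ ENNReal.ofReal c • densityMeasure b := by
  unfold densityMeasure
  rw [← withDensity_smul _ hb.ennreal_ofReal]
  refine withDensity_mono (Filter.Eventually.of_forall fun x => ?_)
  simp only [Pi.smul_apply, smul_eq_mul]
  rw [← ENNReal.ofReal_mul hc]
  exact ENNReal.ofReal_le_ofReal (hab x)

/-- A pair of nonzero integrable densities of equal mass with ratio between `c⁻¹` and `c`. -/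
structure ComparableDensities (c : ℝ) (a b : EuclideanSpace ℝ (Fin n) → ℝ) : Prop where
  one_le : 1 ≤ c
  measurable_left : Measurable a
  measurable_right : Measurable b
  nonneg_left : ∀ x, 0 ≤ a x
  nonneg_right : ∀ x, 0 ≤ b x
  integrable_left : Integrable a
  integrable_right : Integrable b
  integral_eq : ∫ x, a x = ∫ x, b x
  integral_pos : 0 < ∫ x, a x
  left_le : ∀ x, a x ≤ c * b x
  right_le : ∀ x, b x ≤ c * a x

theorem densityMeasure_univ {a : EuclideanSpace ℝ (Fin n) → ℝ} (ha0 : ∀ x, 0 ≤ a x)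
    (hi : Integrable a) : densityMeasure a Set.univ = ENNReal.ofReal (∫ x, a x) := by
  rw [densityMeasure, withDensity_apply _ MeasurableSet.univ, Measure.restrict_univ,
    ofReal_integral_eq_lintegral_ofReal hi (Filter.Eventually.of_forall ha0)]

theorem isFiniteMeasure_densityMeasure {a : EuclideanSpace ℝ (Fin n) → ℝ}
    (hi : Integrable a) : IsFiniteMeasure (densityMeasure a) :=
  isFiniteMeasure_withDensity_ofReal hi.2

theorem neZero_densityMeasure {a : EuclideanSpace ℝ (Fin n) → ℝ} (ha0 : ∀ x, 0 ≤ a x)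
    (hi : Integrable a) (hpos : 0 < ∫ x, a x) : NeZero (densityMeasure a) := by
  refine ⟨fun h => ?_⟩
  have := densityMeasure_univ ha0 hi
  rw [h] at this
  simp only [Measure.coe_zero, Pi.zero_apply] at this
  exact (ENNReal.ofReal_pos.2 hpos).ne this

variable {a b : EuclideanSpace ℝ (Fin n) → ℝ}

theorem ComparableDensities.integrable_mul_log (h : ComparableDensities c a b) :
    Integrable fun x => a x * Real.log (a x / b x) := by
  refine (h.integrable_left.const_mul (Real.log c)).mono' ?_
    (Filter.Eventually.of_forall fun x => ?_)
  · have h1 := h.measurable_left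
    have h2 := h.measurable_right
    exact (h1.mul (h1.div h2).log).aestronglyMeasurable
  · rcases (h.nonneg_left x).eq_or_lt with h0 | h0
    · simp [← h0]
    have hb : 0 < b x := by nlinarith [h.left_le x, h.one_le, h.nonneg_right x]
    rw [norm_mul, Real.norm_of_nonneg h0.le, mul_comm]
    gcongr
    exact abs_log_div_le h0 hb (h.left_le x) (h.right_le x)

theorem ComparableDensities.mutuallyBounded (h : ComparableDensities c a b) :
    MutuallyBounded c (densityMeasure a) (densityMeasure b) where
  pos := by linarith [h.one_le]
  left := densityMeasure_le_smul (by linarith [h.one_le]) h.measurable_right h.left_le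
  right := densityMeasure_le_smul (by linarith [h.one_le]) h.measurable_left h.right_le

theorem ComparableDensities.tendsto_smoothedEntropy_zero (h : ComparableDensities c a b) :
    Filter.Tendsto (smoothedEntropy (densityMeasure a) (densityMeasure b))
      (nhdsWithin 0 (Set.Ioi 0)) (nhds (∫ x, a x * Real.log (a x / b x))) := by
  have hc := h.one_le
  have := isFiniteMeasure_densityMeasure h.integrable_left
  have := isFiniteMeasure_densityMeasure h.integrable_right
  have := neZero_densityMeasure h.nonneg_left h.integrable_left h.integral_pos
  have := neZero_densityMeasure h.nonneg_right h.integrable_right (h.integral_eq ▸ h.integral_pos)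
  have hM := h.mutuallyBounded
  refine tendsto_integral_of_L1 _ h.integrable_mul_log.aestronglyMeasurable ?_ ?_
  · filter_upwards [self_mem_nhdsWithin] with σ hσ
    exact integrable_smoothedEntropy hM hσ
  have h2 := ENNReal.Tendsto.const_mul (a := ENNReal.ofReal (Real.log c + 1 + c))
    ((tendsto_gaussianSmoothing_sub_zero h.measurable_left h.nonneg_left h.integrable_left).add
    (tendsto_gaussianSmoothing_sub_zero h.measurable_right h.nonneg_right h.integrable_right))
    (Or.inr ENNReal.ofReal_ne_top)
  rw [add_zero, mul_zero] at h2
  refine tendsto_of_tendsto_of_tendsto_of_le_of_le' tendsto_const_nhds h2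
    (Filter.Eventually.of_forall fun _ => zero_le) ?_
  filter_upwards [self_mem_nhdsWithin] with σ hσ
  have hm1 := (continuous_gaussianSmoothing (α := densityMeasure a) hσ).measurable
  have hm2 := h.measurable_left
  rw [← lintegral_add_left (by fun_prop), ← lintegral_const_mul' _ _ ENNReal.ofReal_ne_top]
  refine lintegral_mono fun y => ?_
  have hu := gaussianSmoothing_pos (α := densityMeasure a) hσ y
  have hv := gaussianSmoothing_pos (α := densityMeasure b) hσ y
  have := abs_mul_log_div_sub_le hu.le (h.nonneg_left y) hc hv.le (h.nonneg_right y)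
    (gaussianSmoothing_le_mul hM.pos.le hM.left hσ y)
    (gaussianSmoothing_le_mul hM.pos.le hM.right hσ y) (h.left_le y) (h.right_le y)
  simp only [← ofReal_norm]
  rw [← ENNReal.ofReal_add (norm_nonneg _) (norm_nonneg _), ← ENNReal.ofReal_mul (by
    linarith [Real.log_nonneg hc])]
  exact ENNReal.ofReal_le_ofReal this

theorem fisherDensity_nonneg (σ : ℝ) (α β : Measure (EuclideanSpace ℝ (Fin n))) (i : Fin n)
    (y : EuclideanSpace ℝ (Fin n)) : 0 ≤ fisherDensity σ α β i y :=
  mul_nonneg (gaussianSmoothing_nonneg _ _ _) (sq_nonneg _)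

/-- The entropy identity for a pair of comparable densities. -/
theorem ComparableDensities.integral_fisherDensity (h : ComparableDensities c a b) :
    IntegrableOn (fun σ => σ * ∑ i, ∫ y, fisherDensity σ (densityMeasure a) (densityMeasure b) i y)
      (Set.Ioi 0) ∧
    ∫ σ in Set.Ioi 0, σ * ∑ i, ∫ y, fisherDensity σ (densityMeasure a) (densityMeasure b) i y =
      ∫ x, a x * Real.log (a x / b x) := by
  have := isFiniteMeasure_densityMeasure h.integrable_left
  have := isFiniteMeasure_densityMeasure h.integrable_right
  have := neZero_densityMeasure h.nonneg_left h.integrable_left h.integral_pos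
  have := neZero_densityMeasure h.nonneg_right h.integrable_right (h.integral_eq ▸ h.integral_pos)
  have hm : (densityMeasure a).real Set.univ = (densityMeasure b).real Set.univ := by
    simp only [measureReal_def]
    rw [densityMeasure_univ h.nonneg_left h.integrable_left,
      densityMeasure_univ h.nonneg_right h.integrable_right, h.integral_eq]
  -- The value at σ = 0 is reset to the limit, since the fundamental theorem of calculus on the
  -- half-line asks for continuity at the endpoint.
  set F := Function.update (smoothedEntropy (densityMeasure a) (densityMeasure b)) 0
    (∫ x, a x * Real.log (a x / b x)) with hF
  have hcont : ContinuousWithinAt F (Set.Ici 0) 0 := by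
    rw [hF, continuousWithinAt_update_same, Set.Ici_sdiff_left]
    exact h.tendsto_smoothedEntropy_zero
  have hderiv : ∀ σ ∈ Set.Ioi (0 : ℝ), HasDerivAt F
      (-(σ * ∑ i, ∫ y, fisherDensity σ (densityMeasure a) (densityMeasure b) i y)) σ := by
    intro σ hσ
    refine (hasDerivAt_smoothedEntropy h.mutuallyBounded hσ).congr_of_eventuallyEq ?_
    filter_upwards [Ioi_mem_nhds hσ] with s hs
    exact Function.update_of_ne (ne_of_gt hs) _ _
  -- The sign of the derivative, together with the finite limits, yields integrability over the
  -- half-line.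
  have hneg : ∀ σ ∈ Set.Ioi (0 : ℝ),
      (-(σ * ∑ i, ∫ y, fisherDensity σ (densityMeasure a) (densityMeasure b) i y)) ≤ 0 := by
    intro σ hσ
    refine neg_nonpos.2 (mul_nonneg (le_of_lt hσ) (Finset.sum_nonneg fun i _ => ?_))
    exact integral_nonneg fun y => fisherDensity_nonneg _ _ _ _ _
  have htop : Filter.Tendsto F Filter.atTop (nhds 0) := by
    refine (tendsto_smoothedEntropy_atTop h.mutuallyBounded h.one_le hm).congr' ?_
    filter_upwards [Filter.eventually_gt_atTop 0] with s hs
    exact (Function.update_of_ne (ne_of_gt hs) _ _).symm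
  refine ⟨?_, ?_⟩
  · simpa using (integrableOn_Ioi_deriv_of_nonpos hcont hderiv hneg htop).neg
  · have := integral_Ioi_of_hasDerivAt_of_nonpos hcont hderiv hneg htop
    rw [integral_neg, zero_sub, neg_inj] at this
    rw [this, hF, Function.update_self]

end EntropyIdentity

/-! ### The Kullback-Leibler divergence as a limit of regularized entropies -/

section Regularization

/-- The limit itself is the upper bound: monotonicity controls the limsup and Fatou's lemma the
liminf. No monotonicity in k is needed, and the limit integral may be infinite. -/
theorem tendsto_lintegral_of_le_of_tendsto {X : Type*} [MeasurableSpace X] {μ : Measure X}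
    {f : ℕ → X → ℝ≥0∞} {g : X → ℝ≥0∞} (hf : ∀ k, AEMeasurable (f k) μ)
    (hle : ∀ k, ∀ᵐ x ∂μ, f k x ≤ g x)
    (hlim : ∀ᵐ x ∂μ, Filter.Tendsto (fun k => f k x) Filter.atTop (nhds (g x))) :
    Filter.Tendsto (fun k => ∫⁻ x, f k x ∂μ) Filter.atTop (nhds (∫⁻ x, g x ∂μ)) := by
  refine tendsto_of_le_liminf_of_limsup_le ?_ ?_
  · refine le_trans (le_of_eq ?_) (lintegral_liminf_le' hf)
    exact lintegral_congr_ae (hlim.mono fun x hx => hx.liminf_eq.symm)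
  · exact Filter.limsup_le_of_le
      (h := Filter.Eventually.of_forall fun k => lintegral_mono_ae (hle k))

/-- The relative entropy density `b φ(a / b)` with `φ(t) = t log t + 1 - t`. -/
noncomputable def entropyDensity (a b : ℝ) : ℝ≥0∞ :=
  if b = 0 then (if a = 0 then 0 else ∞) else ENNReal.ofReal (a * Real.log (a / b) - (a - b))

/-- The relative entropy density of `a + ε b` and `b + ε a`. -/
noncomputable def regularizedEntropyDensity (ε a b : ℝ) : ℝ :=
  (a + ε * b) * Real.log ((a + ε * b) / (b + ε * a)) - (1 - ε) * (a - b)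

/-- With A = a + εb and B = b + εa one has A − B = (1 − ε)(a − b), so the quantity is A log(A/B) − A
+ B, nonnegative by log t ≥ 1 − 1/t. -/
theorem regularizedEntropyDensity_nonneg {ε a b : ℝ} (hε : 0 < ε) (ha : 0 ≤ a) (hb : 0 ≤ b) :
    0 ≤ regularizedEntropyDensity ε a b := by
  unfold regularizedEntropyDensity
  rcases (by positivity : 0 ≤ a + b).eq_or_lt with h | h
  · have ha0 : a = 0 := by linarith
    have hb0 : b = 0 := by linarith
    simp [ha0, hb0]
  have hA : 0 < a + ε * b := by
    rcases ha.eq_or_lt with rfl | ha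
    · have : 0 < b := by linarith
      positivity
    · positivity
  have hB : 0 < b + ε * a := by
    rcases hb.eq_or_lt with rfl | hb
    · have : 0 < a := by linarith
      positivity
    · positivity
  have h1 := Real.one_sub_inv_le_log_of_pos (div_pos hA hB)
  have h2 := mul_le_mul_of_nonneg_left h1 hA.le
  have h3 : (a + ε * b) * (1 - ((a + ε * b) / (b + ε * a))⁻¹) = (1 - ε) * (a - b) := by
    field_simp
    ring
  linarith

/-- With R = (a + εb)/(b + εa), the estimates a log(a/b) ≥ a log R + a − bR and log R ≤ R − 1 remove
the logarithms and leave a rational inequality. -/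
theorem regularizedEntropyDensity_le_entropyDensity {ε a b : ℝ} (hε : 0 < ε) (hε1 : ε < 1)
    (ha : 0 ≤ a) (hb : 0 ≤ b) :
    ENNReal.ofReal (regularizedEntropyDensity ε a b) ≤ entropyDensity a b := by
  unfold entropyDensity
  rcases hb.eq_or_lt with rfl | hb
  · rcases ha.eq_or_lt with rfl | ha
    · simp [regularizedEntropyDensity]
    · simp [ha.ne']
  rw [if_neg hb.ne']
  refine ENNReal.ofReal_le_ofReal ?_
  unfold regularizedEntropyDensity
  rcases ha.eq_or_lt with rfl | ha
  · have h1 : (0 + ε * b) / (b + ε * 0) = ε := by field_simp; ring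
    rw [h1]
    have := Real.log_nonpos hε.le hε1.le
    nlinarith [mul_pos hε hb]
  set R := (a + ε * b) / (b + ε * a) with hR
  have hR0 : 0 < R := by positivity
  have h1 := Real.one_sub_inv_le_log_of_pos (x := (a / b) / R) (by positivity)
  rw [Real.log_div (by positivity) hR0.ne'] at h1
  have h2 := mul_le_mul_of_nonneg_left h1 ha.le
  have h3 : a * (1 - (a / b / R)⁻¹) = a - b * R := by field_simp
  have h4 := Real.log_le_sub_one_of_pos hR0
  have h5 := mul_le_mul_of_nonneg_left h4 (mul_pos hε hb).le
  -- After clearing the denominator the two sides differ by exactly ε(1 − ε)(a − b)².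
  have h6 : b * (1 + ε) * R ≤ (1 - ε) * a + 2 * ε * b := by
    rw [hR, ← mul_div_assoc, div_le_iff₀ (by positivity)]
    nlinarith [mul_nonneg (mul_nonneg hε.le (sub_nonneg.2 hε1.le)) (sq_nonneg (a - b))]
  rw [h3] at h2
  nlinarith

theorem tendsto_regularizedEntropyDensity {a b : ℝ} (ha : 0 ≤ a) (hb : 0 ≤ b) {ε : ℕ → ℝ}
    (hε : ∀ k, 0 < ε k) (hlim : Filter.Tendsto ε Filter.atTop (nhds 0)) :
    Filter.Tendsto (fun k => ENNReal.ofReal (regularizedEntropyDensity (ε k) a b)) Filter.atTop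
      (nhds (entropyDensity a b)) := by
  unfold entropyDensity
  rcases hb.eq_or_lt with rfl | hb
  · rcases ha.eq_or_lt with rfl | ha
    · simp [regularizedEntropyDensity]
    rw [if_pos rfl, if_neg ha.ne']
    refine ENNReal.tendsto_ofReal_nhds_top.2 ?_
    have h0 : Filter.Tendsto ε Filter.atTop (nhdsWithin 0 (Set.Ioi 0)) :=
      tendsto_nhdsWithin_iff.2 ⟨hlim, Filter.Eventually.of_forall hε⟩
    have h1 : Filter.Tendsto (fun k => Real.log (ε k)⁻¹) Filter.atTop Filter.atTop :=
      Real.tendsto_log_atTop.comp h0.inv_tendsto_nhdsGT_zero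
    have h2 : Filter.Tendsto (fun k => a * Real.log (ε k)⁻¹ + -a) Filter.atTop Filter.atTop :=
      Filter.tendsto_atTop_add_const_right _ _ (h1.const_mul_atTop ha)
    refine Filter.tendsto_atTop_mono (fun k => ?_) h2
    have e : (a + ε k * 0) / (0 + ε k * a) = (ε k)⁻¹ := by
      have := (hε k).ne'
      field_simp
      ring
    rw [regularizedEntropyDensity, e]
    nlinarith [mul_pos (hε k) ha]
  rw [if_neg hb.ne']
  refine ENNReal.tendsto_ofReal ?_
  -- Rewritten through R log R, which is continuous at R = 0, so that a = 0 needs no separate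
  -- treatment.
  have hR (e : ℝ) (he : 0 ≤ e) : regularizedEntropyDensity e a b = (b + e * a) *
      ((a + e * b) / (b + e * a) * Real.log ((a + e * b) / (b + e * a))) - (1 - e) * (a - b) := by
    rw [regularizedEntropyDensity]
    congr 1
    have : 0 < b + e * a := by positivity
    rw [← mul_assoc, mul_div_cancel₀ _ this.ne']
  have hcont : ContinuousAt (fun e => (b + e * a) *
      ((a + e * b) / (b + e * a) * Real.log ((a + e * b) / (b + e * a))) - (1 - e) * (a - b))
      (0 : ℝ) := by
    have h1 : ContinuousAt (fun e : ℝ => (a + e * b) / (b + e * a)) 0 := by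
      refine ContinuousAt.div (by fun_prop) (by fun_prop) ?_
      simpa using hb.ne'
    have h2 : ContinuousAt (fun e : ℝ => (a + e * b) / (b + e * a) *
        Real.log ((a + e * b) / (b + e * a))) 0 :=
      (Real.continuous_mul_log.continuousAt).comp h1
    exact ((by fun_prop : ContinuousAt (fun e : ℝ => b + e * a) 0).mul h2).sub (by fun_prop)
  have h3 := hcont.tendsto.comp hlim
  refine (h3.congr fun k => (hR (ε k) (hε k).le).symm).trans (le_of_eq ?_)
  have := hb.ne'
  congr 1
  simp only [zero_mul, add_zero, sub_zero, one_mul]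
  field_simp

/-! ### The divergence of two probability densities and its regularization -/

variable {n : ℕ} {p q : EuclideanSpace ℝ (Fin n) → ℝ}

theorem IsProbDensity.integrable (hp : IsProbDensity p) : Integrable p := by
  refine ⟨hp.measurable.aestronglyMeasurable, ?_⟩
  rw [hasFiniteIntegral_iff_ofReal (Filter.Eventually.of_forall hp.nonneg), hp.lintegral_eq_one]
  exact ENNReal.one_lt_top

theorem IsProbDensity.integral_eq_one (hp : IsProbDensity p) : ∫ x, p x = 1 := by
  rw [integral_eq_lintegral_of_nonneg_ae (Filter.Eventually.of_forall hp.nonneg)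
    hp.measurable.aestronglyMeasurable, hp.lintegral_eq_one, ENNReal.toReal_one]

theorem IsProbDensity.isProbabilityMeasure (hp : IsProbDensity p) :
    IsProbabilityMeasure (densityMeasure p) := by
  refine ⟨?_⟩
  rw [densityMeasure_univ hp.nonneg hp.integrable, hp.integral_eq_one, ENNReal.ofReal_one]

theorem IsProbDensity.absolutelyContinuous_iff (hp : IsProbDensity p) (hq : IsProbDensity q) :
    densityMeasure p ≪ densityMeasure q ↔ ∀ᵐ x, q x = 0 → p x = 0 := by
  have hm : MeasurableSet {x | q x = 0} := hq.measurable (measurableSet_singleton 0)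
  constructor
  · intro h
    have h1 : densityMeasure q {x | q x = 0} = 0 := by
      rw [densityMeasure, withDensity_apply _ hm]
      refine setLIntegral_eq_zero hm fun x hx => ?_
      have hx' : q x = 0 := hx
      simp [hx']
    have h2 := h h1
    rw [densityMeasure, withDensity_apply _ hm, setLIntegral_eq_zero_iff hm
      hp.measurable.ennreal_ofReal] at h2
    filter_upwards [h2] with x hx hq0
    exact le_antisymm (ENNReal.ofReal_eq_zero.1 (hx hq0)) (hp.nonneg x)
  · intro h
    refine Measure.AbsolutelyContinuous.mk fun s hs h0 => ?_
    rw [densityMeasure, withDensity_apply _ hs, setLIntegral_eq_zero_iff hs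
      hq.measurable.ennreal_ofReal] at h0
    rw [densityMeasure, withDensity_apply _ hs, setLIntegral_eq_zero_iff hs
      hp.measurable.ennreal_ofReal]
    filter_upwards [h, h0] with x hx hx0 hxs
    rw [hx (le_antisymm (ENNReal.ofReal_eq_zero.1 (hx0 hxs)) (hq.nonneg x)), ENNReal.ofReal_zero]

theorem measurable_entropyDensity (hp : Measurable p) (hq : Measurable q) :
    Measurable fun x => entropyDensity (p x) (q x) := by
  unfold entropyDensity
  refine Measurable.ite (hq (measurableSet_singleton 0))
    (Measurable.ite (hp (measurableSet_singleton 0)) measurable_const measurable_const) ?_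
  exact ((hp.mul (hp.div hq).log).sub (hp.sub hq)).ennreal_ofReal

/-- Under absolute continuity the Radon–Nikodym derivative is p/q, and q·φ(p/q) with φ(t) = t log t
+ 1 − t is the entropy density. The correction term −(p − q) keeps the integrand nonnegative. -/
theorem IsProbDensity.klDiv_eq_lintegral (hp : IsProbDensity p) (hq : IsProbDensity q) :
    InformationTheory.klDiv (densityMeasure p) (densityMeasure q) =
      ∫⁻ x, entropyDensity (p x) (q x) := by
  have := hp.isProbabilityMeasure
  have := hq.isProbabilityMeasure
  rw [InformationTheory.klDiv_eq_lintegral_klFun]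
  split_ifs with h
  · rw [hp.absolutelyContinuous_iff hq] at h
    have hpm := hp.measurable
    have hqm := hq.measurable
    have hr : Measurable fun x => ENNReal.ofReal (p x / q x) := (hpm.div hqm).ennreal_ofReal
    have h1 : densityMeasure p =
        (densityMeasure q).withDensity (fun x => ENNReal.ofReal (p x / q x)) := by
      unfold densityMeasure
      rw [← withDensity_mul _ hqm.ennreal_ofReal hr]
      refine withDensity_congr_ae ?_
      filter_upwards [h] with x hx
      rw [Pi.mul_apply, ← ENNReal.ofReal_mul (hq.nonneg x)]
      congr 1
      by_cases hq0 : q x = 0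
      · simp [hq0, hx hq0]
      · field_simp
    have h2 : (densityMeasure p).rnDeriv (densityMeasure q) =ᵐ[densityMeasure q]
        fun x => ENNReal.ofReal (p x / q x) := by
      rw [h1]
      exact Measure.rnDeriv_withDensity _ hr
    have h3 : ∫⁻ x, ENNReal.ofReal (InformationTheory.klFun
        ((densityMeasure p).rnDeriv (densityMeasure q) x).toReal) ∂(densityMeasure q) =
        ∫⁻ x, ENNReal.ofReal (InformationTheory.klFun (p x / q x)) ∂(densityMeasure q) := by
      refine lintegral_congr_ae ?_
      filter_upwards [h2] with x hx
      rw [hx, ENNReal.toReal_ofReal (div_nonneg (hp.nonneg x) (hq.nonneg x))]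
    have h4 : Measurable fun x => ENNReal.ofReal (InformationTheory.klFun (p x / q x)) :=
      (InformationTheory.measurable_klFun.comp (hpm.div hqm)).ennreal_ofReal
    rw [h3, densityMeasure, lintegral_withDensity_eq_lintegral_mul _ hqm.ennreal_ofReal h4]
    refine lintegral_congr_ae ?_
    filter_upwards [h] with x hx
    rw [Pi.mul_apply, ← ENNReal.ofReal_mul (hq.nonneg x), entropyDensity]
    by_cases hq0 : q x = 0
    · simp [hq0, hx hq0]
    · rw [if_neg hq0, InformationTheory.klFun]
      congr 1
      field_simp
      ring
  -- Without absolute continuity both sides are infinite: a finite integral would make the density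
  -- finite almost everywhere, forcing p = 0 wherever q = 0.
  · symm
    by_contra htop
    refine h ((hp.absolutelyContinuous_iff hq).2 ?_)
    filter_upwards [ae_lt_top (measurable_entropyDensity hp.measurable hq.measurable) htop]
      with x hx hq0
    by_contra hp0
    simp [entropyDensity, hq0, hp0] at hx

/-- Mixing in both directions gives equal masses 1 + ε and a ratio between ε and 1/ε. -/
theorem IsProbDensity.comparableDensities {ε : ℝ} (hp : IsProbDensity p) (hq : IsProbDensity q)
    (hε : 0 < ε) (hε1 : ε < 1) :
    ComparableDensities ε⁻¹ (fun x => p x + ε * q x) (fun x => q x + ε * p x) where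
  one_le := (one_le_inv₀ hε).2 hε1.le
  measurable_left := hp.measurable.add (hq.measurable.const_mul ε)
  measurable_right := hq.measurable.add (hp.measurable.const_mul ε)
  nonneg_left x := add_nonneg (hp.nonneg x) (mul_nonneg hε.le (hq.nonneg x))
  nonneg_right x := add_nonneg (hq.nonneg x) (mul_nonneg hε.le (hp.nonneg x))
  integrable_left := hp.integrable.add (hq.integrable.const_mul ε)
  integrable_right := hq.integrable.add (hp.integrable.const_mul ε)
  integral_eq := by
    rw [integral_add hp.integrable (hq.integrable.const_mul ε),
      integral_add hq.integrable (hp.integrable.const_mul ε), integral_const_mul,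
      integral_const_mul, hp.integral_eq_one, hq.integral_eq_one]
  integral_pos := by
    rw [integral_add hp.integrable (hq.integrable.const_mul ε), integral_const_mul,
      hp.integral_eq_one, hq.integral_eq_one]
    positivity
  left_le x := by
    have h1 := hp.nonneg x
    have h2 := hq.nonneg x
    rw [inv_mul_eq_div, le_div_iff₀ hε]
    nlinarith [mul_nonneg hε.le h2]
  right_le x := by
    have h1 := hp.nonneg x
    have h2 := hq.nonneg x
    rw [inv_mul_eq_div, le_div_iff₀ hε]
    nlinarith [mul_nonneg hε.le h1]

/-- The linear correction integrates to zero because p and q have the same mass. -/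
theorem IsProbDensity.ofReal_integral_regularized {ε : ℝ} (hp : IsProbDensity p)
    (hq : IsProbDensity q) (hε : 0 < ε) (hε1 : ε < 1) :
    ENNReal.ofReal (∫ x, (p x + ε * q x) * Real.log ((p x + ε * q x) / (q x + ε * p x))) =
      ∫⁻ x, ENNReal.ofReal (regularizedEntropyDensity ε (p x) (q x)) := by
  have hi := (hp.comparableDensities hq hε hε1).integrable_mul_log
  have hi2 : Integrable fun x => (1 - ε) * (p x - q x) :=
    (hp.integrable.sub hq.integrable).const_mul _
  have hi3 : Integrable fun x => regularizedEntropyDensity ε (p x) (q x) := hi.sub hi2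
  rw [← ofReal_integral_eq_lintegral_ofReal hi3 (Filter.Eventually.of_forall fun x =>
    regularizedEntropyDensity_nonneg hε (hp.nonneg x) (hq.nonneg x))]
  congr 1
  unfold regularizedEntropyDensity
  rw [integral_sub hi hi2, integral_const_mul, integral_sub hp.integrable hq.integrable,
    hp.integral_eq_one, hq.integral_eq_one]
  simp

/-! ### The relative Fisher information of the mixtures and the limit ε → 0 -/

theorem densityMeasure_add_mul {ε : ℝ} (hp : IsProbDensity p) (hq : IsProbDensity q)
    (hε : 0 ≤ ε) :
    densityMeasure (fun x => p x + ε * q x) =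
      densityMeasure p + ENNReal.ofReal ε • densityMeasure q := by
  unfold densityMeasure
  rw [← withDensity_smul _ hq.measurable.ennreal_ofReal,
    ← withDensity_add_left hp.measurable.ennreal_ofReal]
  congr 1
  ext x
  simp only [Pi.add_apply, Pi.smul_apply, smul_eq_mul]
  rw [ENNReal.ofReal_add (hp.nonneg x) (mul_nonneg hε (hq.nonneg x)), ENNReal.ofReal_mul hε]

theorem kernelSmoothing_add_smul {k : EuclideanSpace ℝ (Fin n) → ℝ} (hk : Continuous k) {C : ℝ}
    (hC : ∀ z, |k z| ≤ C) {α β : Measure (EuclideanSpace ℝ (Fin n))} [IsFiniteMeasure α]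
    [IsFiniteMeasure β] {ε : ℝ} (hε : 0 ≤ ε) (y : EuclideanSpace ℝ (Fin n)) :
    kernelSmoothing k (α + ENNReal.ofReal ε • β) y =
      kernelSmoothing k α y + ε * kernelSmoothing k β y := by
  unfold kernelSmoothing
  rw [integral_add_measure (integrable_kernel_sub hk hC y)
    ((integrable_kernel_sub hk hC y).smul_measure ENNReal.ofReal_ne_top), integral_smul_measure,
    ENNReal.toReal_ofReal hε, smul_eq_mul]

/-- Smoothing is linear, and the numerator is a Wronskian: passing from (P, Q) to (P + εQ, Q + εP)
multiplies ∂ᵢP·Q − P·∂ᵢQ by the determinant 1 − ε². -/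
theorem IsProbDensity.fisherDensity_regularized {σ ε : ℝ} (hp : IsProbDensity p)
    (hq : IsProbDensity q) (hσ : 0 < σ) (hε : 0 ≤ ε) (i : Fin n) (y : EuclideanSpace ℝ (Fin n)) :
    fisherDensity σ (densityMeasure fun x => p x + ε * q x)
        (densityMeasure fun x => q x + ε * p x) i y =
      (1 - ε ^ 2) ^ 2 * (gaussianSmoothingPartial σ (densityMeasure p) i y
          * gaussianSmoothing σ (densityMeasure q) y - gaussianSmoothing σ (densityMeasure p) y
          * gaussianSmoothingPartial σ (densityMeasure q) i y) ^ 2 /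
        ((gaussianSmoothing σ (densityMeasure p) y + ε * gaussianSmoothing σ (densityMeasure q) y) *
        (gaussianSmoothing σ (densityMeasure q) y + ε * gaussianSmoothing σ (densityMeasure p) y)
          ^ 2) := by
  have := hp.isProbabilityMeasure
  have := hq.isProbabilityMeasure
  obtain ⟨C, hC⟩ := exists_gaussianDensity_le (n := n) hσ
  obtain ⟨C', hC'⟩ := exists_gaussianPartial_le (n := n) hσ i
  have hP := gaussianSmoothing_pos (α := densityMeasure p) hσ y
  have hQ := gaussianSmoothing_pos (α := densityMeasure q) hσ y
  rw [densityMeasure_add_mul hp hq hε, densityMeasure_add_mul hq hp hε, fisherDensity]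
  have e1 {a b : EuclideanSpace ℝ (Fin n) → ℝ} [IsProbabilityMeasure (densityMeasure a)]
      [IsProbabilityMeasure (densityMeasure b)] :
      gaussianSmoothing σ (densityMeasure a + ENNReal.ofReal ε • densityMeasure b) y =
      gaussianSmoothing σ (densityMeasure a) y + ε * gaussianSmoothing σ (densityMeasure b) y :=
    kernelSmoothing_add_smul (continuous_gaussianDensity σ) hC hε y
  have e2 {a b : EuclideanSpace ℝ (Fin n) → ℝ} [IsProbabilityMeasure (densityMeasure a)]
      [IsProbabilityMeasure (densityMeasure b)] :
      gaussianSmoothingPartial σ (densityMeasure a + ENNReal.ofReal ε • densityMeasure b) i y =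
      gaussianSmoothingPartial σ (densityMeasure a) i y
        + ε * gaussianSmoothingPartial σ (densityMeasure b) i y :=
    kernelSmoothing_add_smul (continuous_gaussianPartial σ i) hC' hε y
  rw [e1, e1, e2, e2]
  field_simp
  ring

theorem IsProbDensity.fisherDensity_eq_div {σ : ℝ} (hp : IsProbDensity p)
    (hq : IsProbDensity q) (hσ : 0 < σ) (i : Fin n) (y : EuclideanSpace ℝ (Fin n)) :
    fisherDensity σ (densityMeasure p) (densityMeasure q) i y =
      (gaussianSmoothingPartial σ (densityMeasure p) i y
          * gaussianSmoothing σ (densityMeasure q) y - gaussianSmoothing σ (densityMeasure p) y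
          * gaussianSmoothingPartial σ (densityMeasure q) i y) ^ 2 /
        (gaussianSmoothing σ (densityMeasure p) y * gaussianSmoothing σ (densityMeasure q) y ^ 2)
      := by
  simpa using hp.fisherDensity_regularized hq hσ le_rfl i y

/-- In the Wronskian form, the mixing can only shrink the numerator and enlarge the denominator. -/
theorem IsProbDensity.fisherDensity_regularized_le {σ ε : ℝ} (hp : IsProbDensity p)
    (hq : IsProbDensity q) (hσ : 0 < σ) (hε : 0 ≤ ε) (hε1 : ε ≤ 1) (i : Fin n)
    (y : EuclideanSpace ℝ (Fin n)) :
    fisherDensity σ (densityMeasure fun x => p x + ε * q x)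
        (densityMeasure fun x => q x + ε * p x) i y ≤
      fisherDensity σ (densityMeasure p) (densityMeasure q) i y := by
  have := hp.isProbabilityMeasure
  have := hq.isProbabilityMeasure
  have hP := gaussianSmoothing_pos (α := densityMeasure p) hσ y
  have hQ := gaussianSmoothing_pos (α := densityMeasure q) hσ y
  rw [hp.fisherDensity_regularized hq hσ hε, hp.fisherDensity_eq_div hq hσ]
  have h1 : (1 - ε ^ 2) ^ 2 ≤ 1 := by
    refine pow_le_one₀ ?_ ?_ <;> nlinarith
  gcongr
  · exact mul_le_of_le_one_left (sq_nonneg _) h1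
  · exact le_add_of_nonneg_right (by positivity)
  · exact le_add_of_nonneg_right (by positivity)

theorem IsProbDensity.tendsto_fisherDensity_regularized {σ : ℝ} (hp : IsProbDensity p)
    (hq : IsProbDensity q) (hσ : 0 < σ) {ε : ℕ → ℝ} (hε : ∀ k, 0 < ε k)
    (hlim : Filter.Tendsto ε Filter.atTop (nhds 0)) (i : Fin n) (y : EuclideanSpace ℝ (Fin n)) :
    Filter.Tendsto (fun k => fisherDensity σ (densityMeasure fun x => p x + ε k * q x)
        (densityMeasure fun x => q x + ε k * p x) i y) Filter.atTop
      (nhds (fisherDensity σ (densityMeasure p) (densityMeasure q) i y)) := by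
  have := hp.isProbabilityMeasure
  have := hq.isProbabilityMeasure
  have hP := gaussianSmoothing_pos (α := densityMeasure p) hσ y
  have hQ := gaussianSmoothing_pos (α := densityMeasure q) hσ y
  simp_rw [fun k => hp.fisherDensity_regularized hq hσ (hε k).le i y]
  rw [hp.fisherDensity_eq_div hq hσ]
  set P := gaussianSmoothing σ (densityMeasure p) y
  set Q := gaussianSmoothing σ (densityMeasure q) y
  set D := (gaussianSmoothingPartial σ (densityMeasure p) i y * Q -
    P * gaussianSmoothingPartial σ (densityMeasure q) i y) ^ 2
  have hc : ContinuousAt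
      (fun e : ℝ => (1 - e ^ 2) ^ 2 * D / ((P + e * Q) * (Q + e * P) ^ 2)) 0 := by
    refine ContinuousAt.div (by fun_prop) (by fun_prop) ?_
    simp only [zero_mul, add_zero]
    positivity
  have h := hc.tendsto.comp hlim
  simpa [Function.comp_def] using h

/-- The Kullback-Leibler divergence is the integral of the relative Fisher information along the
Gaussian smoothing. -/
theorem IsProbDensity.klDiv_eq_lintegral_fisherDensity (hp : IsProbDensity p)
    (hq : IsProbDensity q) :
    InformationTheory.klDiv (densityMeasure p) (densityMeasure q) =
      ∫⁻ σ in Set.Ioi (0 : ℝ), (∫⁻ y, ENNReal.ofReal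
        (∑ i, fisherDensity σ (densityMeasure p) (densityMeasure q) i y)) * ENNReal.ofReal σ := by
  -- The shift by 2 keeps every term strictly below 1, also at k = 0.
  set ε : ℕ → ℝ := fun k => 1 / ((k : ℝ) + 2) with hεdef
  have hε (k : ℕ) : 0 < ε k := by positivity
  have hε1 (k : ℕ) : ε k < 1 := by
    rw [hεdef]
    simp only
    rw [div_lt_one (by positivity)]
    linarith [Nat.cast_nonneg (α := ℝ) k]
  have hlim : Filter.Tendsto ε Filter.atTop (nhds 0) :=
    (tendsto_const_nhds (x := (1 : ℝ))).div_atTop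
      (Filter.tendsto_atTop_add_const_right _ _ tendsto_natCast_atTop_atTop)
  have hcomp := fun k => hp.comparableDensities hq (hε k) (hε1 k)
  have hlhs : Filter.Tendsto (fun k =>
      ∫⁻ x, ENNReal.ofReal (regularizedEntropyDensity (ε k) (p x) (q x))) Filter.atTop
      (nhds (InformationTheory.klDiv (densityMeasure p) (densityMeasure q))) := by
    rw [hp.klDiv_eq_lintegral hq]
    refine tendsto_lintegral_of_le_of_tendsto (fun k => ?_)
      (fun k => Filter.Eventually.of_forall fun x => regularizedEntropyDensity_le_entropyDensity
        (hε k) (hε1 k) (hp.nonneg x) (hq.nonneg x))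
      (Filter.Eventually.of_forall fun x => tendsto_regularizedEntropyDensity (hp.nonneg x)
        (hq.nonneg x) hε hlim)
    have h1 := hp.measurable
    have h2 := hq.measurable
    unfold regularizedEntropyDensity
    fun_prop
  have hfi (k : ℕ) (σ : ℝ) (hσ : 0 < σ) (i : Fin n) : Integrable (fisherDensity σ
      (densityMeasure fun x => p x + ε k * q x) (densityMeasure fun x => q x + ε k * p x) i) := by
    have := isFiniteMeasure_densityMeasure (hcomp k).integrable_left
    have := isFiniteMeasure_densityMeasure (hcomp k).integrable_right
    have := neZero_densityMeasure (hcomp k).nonneg_left (hcomp k).integrable_left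
      (hcomp k).integral_pos
    have := neZero_densityMeasure (hcomp k).nonneg_right (hcomp k).integrable_right
      ((hcomp k).integral_eq ▸ (hcomp k).integral_pos)
    exact integrable_fisherDensity (hcomp k).mutuallyBounded hσ i
  have hinner (k : ℕ) (σ : ℝ) (hσ : 0 < σ) :
      ENNReal.ofReal (σ * ∑ i, ∫ y, fisherDensity σ (densityMeasure fun x => p x + ε k * q x)
        (densityMeasure fun x => q x + ε k * p x) i y) =
      (∫⁻ y, ENNReal.ofReal (∑ i, fisherDensity σ (densityMeasure fun x => p x + ε k * q x)
        (densityMeasure fun x => q x + ε k * p x) i y)) * ENNReal.ofReal σ := by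
    rw [← ofReal_integral_eq_lintegral_ofReal (integrable_finsetSum _ fun i _ => hfi k σ hσ i)
      (Filter.Eventually.of_forall fun y =>
        Finset.sum_nonneg fun i _ => fisherDensity_nonneg _ _ _ _ _),
      integral_finsetSum _ fun i _ => hfi k σ hσ i, ENNReal.ofReal_mul hσ.le, mul_comm]
  have hinner_tendsto (σ : ℝ) (hσ : 0 < σ) : Filter.Tendsto (fun k =>
      (∫⁻ y, ENNReal.ofReal (∑ i, fisherDensity σ (densityMeasure fun x => p x + ε k * q x)
        (densityMeasure fun x => q x + ε k * p x) i y)) * ENNReal.ofReal σ) Filter.atTop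
      (nhds ((∫⁻ y, ENNReal.ofReal
        (∑ i, fisherDensity σ (densityMeasure p) (densityMeasure q) i y)) * ENNReal.ofReal σ)) := by
    refine ENNReal.Tendsto.mul_const ?_ (Or.inr ENNReal.ofReal_ne_top)
    refine tendsto_lintegral_of_le_of_tendsto (fun k => ?_)
      (fun k => Filter.Eventually.of_forall fun y => ENNReal.ofReal_le_ofReal
        (Finset.sum_le_sum fun i _ =>
          hp.fisherDensity_regularized_le hq hσ (hε k).le (hε1 k).le i y))
      (Filter.Eventually.of_forall fun y => ENNReal.tendsto_ofReal (tendsto_finsetSum _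
        fun i _ => hp.tendsto_fisherDensity_regularized hq hσ hε hlim i y))
    exact (integrable_finsetSum _
      fun i _ => hfi k σ hσ i).aestronglyMeasurable.aemeasurable.ennreal_ofReal
  have hrhs : Filter.Tendsto (fun k => ∫⁻ σ in Set.Ioi (0 : ℝ),
      ENNReal.ofReal (σ * ∑ i, ∫ y, fisherDensity σ (densityMeasure fun x => p x + ε k * q x)
        (densityMeasure fun x => q x + ε k * p x) i y)) Filter.atTop
      (nhds (∫⁻ σ in Set.Ioi (0 : ℝ), (∫⁻ y, ENNReal.ofReal
        (∑ i, fisherDensity σ (densityMeasure p) (densityMeasure q) i y)) * ENNReal.ofReal σ)) := by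
    -- The same limit argument as for the inner integral over y, now in σ.
    refine tendsto_lintegral_of_le_of_tendsto
      (fun k => (hcomp k).integral_fisherDensity.1.aestronglyMeasurable.aemeasurable.ennreal_ofReal)
      (fun k => ?_) ?_
    · filter_upwards [ae_restrict_mem measurableSet_Ioi] with σ hσ
      rw [hinner k σ hσ]
      gcongr
      exact hp.fisherDensity_regularized_le hq hσ (hε k).le (hε1 k).le _ _
    · filter_upwards [ae_restrict_mem measurableSet_Ioi] with σ hσ
      simp_rw [fun k => hinner k σ hσ]
      exact hinner_tendsto σ hσ
  -- For each k the two sequences agree by the entropy identity for comparable densities, hence so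
  -- do their limits.
  refine tendsto_nhds_unique hlhs (hrhs.congr fun k => ?_)
  rw [← hp.ofReal_integral_regularized hq (hε k) (hε1 k),
    ← (hcomp k).integral_fisherDensity.2,
    ofReal_integral_eq_lintegral_ofReal (hcomp k).integral_fisherDensity.1]
  filter_upwards [ae_restrict_mem measurableSet_Ioi] with σ hσ
  exact mul_nonneg (le_of_lt hσ) (Finset.sum_nonneg fun i _ =>
    integral_nonneg fun y => fisherDensity_nonneg _ _ _ _ _)

end Regularization

/-! ### The law of the noisy measurement -/

section NoisyMeasurement

variable {n : ℕ} {σ : ℝ}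

/-- Finite measures with equal characteristic functions coincide. -/
theorem multivariateGaussian_eq_densityMeasure (hσ : 0 < σ) :
    multivariateGaussian 0 (σ ^ 2 • (1 : Matrix (Fin n) (Fin n) ℝ)) =
      densityMeasure (gaussianDensity σ) := by
  have := isFiniteMeasure_densityMeasure (integrable_gaussianDensity (n := n) hσ)
  refine Measure.ext_of_charFun ?_
  ext t
  have hS : (σ ^ 2 • (1 : Matrix (Fin n) (Fin n) ℝ)).PosSemidef :=
    Matrix.PosSemidef.one.smul (sq_nonneg σ)
  rw [charFun_multivariateGaussian hS, charFun_apply, densityMeasure,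
    integral_withDensity_eq_integral_toReal_smul
      (continuous_gaussianDensity σ).measurable.ennreal_ofReal
      (Filter.Eventually.of_forall fun _ => ENNReal.ofReal_lt_top)]
  set K : ℝ := (2 * Real.pi * σ ^ 2) ^ (-(n : ℝ) / 2) with hK
  set b : ℂ := ((1 / (2 * σ ^ 2) : ℝ) : ℂ) with hb
  have hbre : 0 < b.re := by
    rw [hb, Complex.ofReal_re]
    positivity
  have e1 (c : ℂ) (v : EuclideanSpace ℝ (Fin n)) :
      (K : ℂ) * Complex.exp (-b * (‖v‖ : ℂ) ^ 2 + c * (inner ℝ t v : ℝ)) =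
        (gaussianDensity σ v : ℂ) * Complex.exp (c * (inner ℝ t v : ℝ)) := by
    rw [gaussianDensity_eq_mul_exp, Complex.exp_add, ← mul_assoc]
    push_cast
    rw [hb]
    push_cast
    rfl
  have e2 (c : ℂ) : ∫ v : EuclideanSpace ℝ (Fin n),
      (gaussianDensity σ v : ℂ) * Complex.exp (c * (inner ℝ t v : ℝ)) =
      (K : ℂ) * ((Real.pi / b) ^ (Module.finrank ℝ (EuclideanSpace ℝ (Fin n)) / 2 : ℂ) *
        Complex.exp (c ^ 2 * (‖t‖ : ℂ) ^ 2 / (4 * b))) := by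
    rw [← GaussianFourier.integral_cexp_neg_mul_sq_norm_add hbre, ← integral_const_mul]
    simp_rw [e1]
  -- Total mass one identifies the prefactor of the Fourier integral, so the complex power never has
  -- to be evaluated.
  have e3 := e2 0
  simp only [zero_mul, Complex.exp_zero, mul_one, ne_eq, OfNat.ofNat_ne_zero, not_false_eq_true,
    zero_pow, zero_div] at e3
  rw [integral_complex_ofReal, integral_gaussianDensity hσ] at e3
  have e4 := e2 Complex.I
  rw [← mul_assoc, ← e3] at e4
  have e5 (x : EuclideanSpace ℝ (Fin n)) : (ENNReal.ofReal (gaussianDensity σ x)).toReal •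
      Complex.exp ((inner ℝ x t : ℝ) * Complex.I) =
      (gaussianDensity σ x : ℂ) * Complex.exp (Complex.I * (inner ℝ t x : ℝ)) := by
    rw [ENNReal.toReal_ofReal (gaussianDensity_nonneg _ _), Complex.real_smul, real_inner_comm,
      mul_comm Complex.I]
  simp_rw [e5]
  rw [e4]
  have e6 : t.ofLp ⬝ᵥ Matrix.mulVec (σ ^ 2 • (1 : Matrix (Fin n) (Fin n) ℝ)) t.ofLp =
      σ ^ 2 * ‖t‖ ^ 2 := by
    rw [Matrix.smul_mulVec, Matrix.one_mulVec, dotProduct_smul, EuclideanSpace.norm_sq_eq,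
      smul_eq_mul, dotProduct]
    simp_rw [Real.norm_eq_abs, sq_abs, sq]
  rw [e6, hb]
  have hσ' : (σ : ℂ) ≠ 0 := by exact_mod_cast hσ.ne'
  simp only [inner_zero_right, Complex.ofReal_zero, zero_mul, zero_sub, Complex.ofReal_one,
    one_mul, Complex.I_sq]
  congr 1
  push_cast
  field_simp
  ring

/-- By independence the law of the sum is a convolution; Tonelli's theorem exhibits its density as
the smoothing of μ. -/
theorem lintegral_noise_eq {Ω : Type*} [MeasurableSpace Ω] {P : Measure Ω}
    [IsProbabilityMeasure P] {μ : Measure (EuclideanSpace ℝ (Fin n))} [IsFiniteMeasure μ]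
    {u z : Ω → EuclideanSpace ℝ (Fin n)} (hu : HasLaw u μ P)
    (hz : HasLaw z (densityMeasure (gaussianDensity σ)) P) (hindep : IndepFun u z P)
    (hσ : 0 < σ) {F : EuclideanSpace ℝ (Fin n) → ℝ≥0∞} (hF : Measurable F) :
    ∫⁻ ω, F (u ω + z ω) ∂P = ∫⁻ y, F y * ENNReal.ofReal (gaussianSmoothing σ μ y) := by
  have := isFiniteMeasure_densityMeasure (integrable_gaussianDensity (n := n) hσ)
  have hc := continuous_gaussianDensity (n := n) σ
  have hlaw := hindep.hasLaw_fun_add hu hz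
  rw [hlaw.lintegral_comp hF.aemeasurable, Measure.lintegral_conv hF]
  have hg : Measurable fun z : EuclideanSpace ℝ (Fin n) => ENNReal.ofReal (gaussianDensity σ z) :=
    hc.measurable.ennreal_ofReal
  have e1 (x : EuclideanSpace ℝ (Fin n)) :
      ∫⁻ w, F (x + w) ∂(densityMeasure (gaussianDensity σ)) =
        ∫⁻ y, F y * ENNReal.ofReal (gaussianDensity σ (y - x)) := by
    have h := lintegral_add_left_eq_self (μ := (volume : Measure (EuclideanSpace ℝ (Fin n))))
      (fun y => F y * ENNReal.ofReal (gaussianDensity σ (y - x))) x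
    rw [← h, densityMeasure, lintegral_withDensity_eq_lintegral_mul _ hg (by fun_prop)]
    refine lintegral_congr fun w => ?_
    rw [Pi.mul_apply, mul_comm, add_sub_cancel_left]
  simp_rw [e1]
  rw [lintegral_lintegral_swap]
  · refine lintegral_congr fun y => ?_
    rw [lintegral_const_mul _ (by fun_prop), gaussianSmoothing, kernelSmoothing,
      ofReal_integral_eq_lintegral_ofReal (integrable_gaussianDensity_sub hσ y)
        (Filter.Eventually.of_forall fun x => gaussianDensity_nonneg _ _)]
  · refine Measurable.aemeasurable ?_
    simp only [Function.uncurry_def]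
    fun_prop

theorem gradient_log_gaussianSmoothing {μ : Measure (EuclideanSpace ℝ (Fin n))}
    [IsFiniteMeasure μ] [NeZero μ] (hσ : 0 < σ) (y : EuclideanSpace ℝ (Fin n)) (i : Fin n) :
    gradient (fun y' => Real.log (gaussianSmoothing σ μ y')) y i =
      gaussianSmoothingPartial σ μ i y / gaussianSmoothing σ μ y := by
  have hpos := gaussianSmoothing_pos (α := μ) hσ y
  have h1 := (hasFDerivAt_gaussianSmoothing (α := μ) hσ y).log hpos.ne'
  have h2 : gradient (fun y' => Real.log (gaussianSmoothing σ μ y')) y i =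
      fderiv ℝ (fun y' => Real.log (gaussianSmoothing σ μ y')) y (EuclideanSpace.single i 1) := by
    rw [gradient, ← InnerProductSpace.toDual_symm_apply (𝕜 := ℝ),
      EuclideanSpace.inner_single_right]
    simp
  have h3 := (hasFDerivAt_gaussianSmoothing (α := μ) hσ y).hasLineDerivAt
    (EuclideanSpace.single i 1)
  rw [h2, h1.fderiv, smul_apply, h3.unique (hasLineDerivAt_gaussianSmoothing hσ i y), smul_eq_mul,
    div_eq_inv_mul]

theorem sum_fisherDensity_eq {μ ν : Measure (EuclideanSpace ℝ (Fin n))}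
    [IsFiniteMeasure μ] [NeZero μ] [IsFiniteMeasure ν] [NeZero ν] (hσ : 0 < σ)
    (y : EuclideanSpace ℝ (Fin n)) :
    ∑ i, fisherDensity σ μ ν i y =
      ‖gradient (fun y' => Real.log (gaussianSmoothing σ μ y')) y -
        gradient (fun y' => Real.log (gaussianSmoothing σ ν y')) y‖ ^ 2 *
        gaussianSmoothing σ μ y := by
  rw [EuclideanSpace.norm_sq_eq, Finset.sum_mul]
  refine Finset.sum_congr rfl fun i _ => ?_
  rw [PiLp.sub_apply, gradient_log_gaussianSmoothing hσ, gradient_log_gaussianSmoothing hσ,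
    Real.norm_eq_abs, sq_abs, mul_comm]
  rfl

theorem measurable_gradient_log_gaussianSmoothing {μ : Measure (EuclideanSpace ℝ (Fin n))}
    [IsFiniteMeasure μ] [NeZero μ] (hσ : 0 < σ) :
    Measurable (gradient fun y' => Real.log (gaussianSmoothing σ μ y')) := by
  refine (MeasurableEquiv.toLp 2 (Fin n → ℝ)).symm.measurableEmbedding.measurable_comp_iff.1 ?_
  refine measurable_pi_iff.2 fun i => ?_
  have : Continuous fun y => gaussianSmoothingPartial σ μ i y / gaussianSmoothing σ μ y :=
    (continuous_gaussianSmoothingPartial hσ i).div (continuous_gaussianSmoothing hσ)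
      fun y => (gaussianSmoothing_pos hσ y).ne'
  convert! this.measurable using 1
  exact funext fun y => gradient_log_gaussianSmoothing hσ y i

/-! ### Reduction to the identity measurement matrix -/

theorem det_toEuclideanLin_ne_zero {H : Matrix (Fin n) (Fin n) ℝ} (hH : IsUnit H) :
    LinearMap.det (H.toEuclideanLin) ≠ 0 := by
  rw [Matrix.toEuclideanLin_eq_toLin_orthonormal, LinearMap.det_toLin]
  exact ((Matrix.isUnit_iff_isUnit_det H).1 hH).ne_zero

theorem measurable_toEuclideanLin (H : Matrix (Fin n) (Fin n) ℝ) :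
    Measurable (H.toEuclideanLin) :=
  (LinearMap.continuous_of_finiteDimensional H.toEuclideanLin).measurable

/-- Only existence of a density for Hx matters, so a Radon–Nikodym derivative replaces the explicit
Jacobian formula. -/
theorem exists_isProbDensity_map {p : EuclideanSpace ℝ (Fin n) → ℝ} (hp : IsProbDensity p)
    {H : Matrix (Fin n) (Fin n) ℝ} (hH : IsUnit H) :
    ∃ p', IsProbDensity p' ∧ densityMeasure p' = (densityMeasure p).map H.toEuclideanLin := by
  have := hp.isProbabilityMeasure
  have hm := measurable_toEuclideanLin H
  have := Measure.isProbabilityMeasure_map (μ := densityMeasure p) hm.aemeasurable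
  set μ := (densityMeasure p).map H.toEuclideanLin with hμ
  have hac : μ ≪ volume := by
    have h1 : densityMeasure p ≪ volume := withDensity_absolutelyContinuous _ _
    refine (h1.map hm).trans ?_
    rw [Measure.map_linearMap_addHaar_eq_smul_addHaar _ (det_toEuclideanLin_ne_zero hH)]
    exact Measure.smul_absolutelyContinuous
  have hdens : densityMeasure (fun x => (μ.rnDeriv volume x).toReal) = μ := by
    conv_rhs => rw [← Measure.withDensity_rnDeriv_eq μ volume hac]
    refine withDensity_congr_ae ?_
    filter_upwards [Measure.rnDeriv_lt_top μ volume] with x hx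
    exact ENNReal.ofReal_toReal hx.ne
  refine ⟨fun x => (μ.rnDeriv volume x).toReal, ⟨(Measure.measurable_rnDeriv _ _).ennreal_toReal,
    fun x => ENNReal.toReal_nonneg, ?_⟩, hdens⟩
  have h := congrArg (fun ν => ν Set.univ) hdens
  simpa [densityMeasure] using h

/-- Data processing applied to `f` and then to its left inverse `g` gives both inequalities. -/
theorem klDiv_map_of_leftInverse {X Y : Type*} [MeasurableSpace X] [MeasurableSpace Y]
    {μ ν : Measure X} [IsFiniteMeasure μ] [IsFiniteMeasure ν] {f : X → Y} {g : Y → X}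
    (hf : Measurable f) (hg : Measurable g) (hgf : Function.LeftInverse g f) :
    InformationTheory.klDiv (μ.map f) (ν.map f) = InformationTheory.klDiv μ ν := by
  refine le_antisymm (InformationTheory.klDiv_map_le _ _ hf) ?_
  have h := InformationTheory.klDiv_map_le (μ.map f) (ν.map f) hg
  rwa [Measure.map_map hg hf, Measure.map_map hg hf, hgf.comp_eq_id, Measure.map_id,
    Measure.map_id] at h

theorem noisyMeasurementDensity_eq {p : EuclideanSpace ℝ (Fin n) → ℝ} (hp : IsProbDensity p)
    (H : Matrix (Fin n) (Fin n) ℝ) (σ : ℝ) :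
    noisyMeasurementDensity H p σ =
      gaussianSmoothing σ ((densityMeasure p).map H.toEuclideanLin) := by
  ext y
  have hc := continuous_gaussianDensity (n := n) σ
  rw [gaussianSmoothing, kernelSmoothing,
    integral_map (measurable_toEuclideanLin H).aemeasurable
      (Continuous.aestronglyMeasurable (by fun_prop)), densityMeasure,
    integral_withDensity_eq_integral_toReal_smul hp.measurable.ennreal_ofReal
    (Filter.Eventually.of_forall fun _ => ENNReal.ofReal_lt_top), noisyMeasurementDensity]
  refine integral_congr_ae (Filter.Eventually.of_forall fun x => ?_)
  simp only [smul_eq_mul, ENNReal.toReal_ofReal (hp.nonneg x)]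
  exact mul_comm _ _

end NoisyMeasurement

/-! ### The identity for a general invertible measurement matrix -/

theorem mainTheorem3 {n : ℕ} {Ω : Type*} [MeasurableSpace Ω] (P : Measure Ω)
    [IsProbabilityMeasure P]
    (p q : EuclideanSpace ℝ (Fin n) → ℝ) (hp : IsProbDensity p) (hq : IsProbDensity q)
    (H : Matrix (Fin n) (Fin n) ℝ) (hH : IsUnit H)
    (x : Ω → EuclideanSpace ℝ (Fin n)) (hx : HasLaw x (densityMeasure p) P)
    (noise : ℝ → Ω → EuclideanSpace ℝ (Fin n))
    (hnoise : ∀ σ : ℝ, 0 < σ →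
      HasLaw (noise σ) (multivariateGaussian 0 (σ ^ 2 • (1 : Matrix (Fin n) (Fin n) ℝ))) P)
    (hindep : ∀ σ : ℝ, 0 < σ → IndepFun x (noise σ) P)
    (y : ℝ → Ω → EuclideanSpace ℝ (Fin n))
    (hy : ∀ σ : ℝ, 0 < σ → ∀ ω, y σ ω = H.toEuclideanLin (x ω) + noise σ ω) :
    InformationTheory.klDiv (densityMeasure p) (densityMeasure q) =
      ∫⁻ σ in Set.Ioi (0 : ℝ),
        (∫⁻ ω, ENNReal.ofReal
          (‖noisyMeasurementScore H p σ (y σ ω) - noisyMeasurementScore H q σ (y σ ω)‖ ^ 2) ∂P)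
          * ENNReal.ofReal σ := by
  obtain ⟨p', hp', hpp'⟩ := exists_isProbDensity_map hp hH
  obtain ⟨q', hq', hqq'⟩ := exists_isProbDensity_map hq hH
  have := hp.isProbabilityMeasure
  have := hq.isProbabilityMeasure
  have := hp'.isProbabilityMeasure
  have := hq'.isProbabilityMeasure
  have hm := measurable_toEuclideanLin H
  have hinv : Function.LeftInverse (H⁻¹.toEuclideanLin) (H.toEuclideanLin) := by
    intro v
    have hdet := (Matrix.isUnit_iff_isUnit_det H).1 hH
    simp [Matrix.toLpLin_apply, Matrix.mulVec_mulVec, Matrix.nonsing_inv_mul H hdet]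
  -- The divergence is moved to the laws of Hx, so that only pure Gaussian smoothing remains.
  rw [← klDiv_map_of_leftInverse hm (measurable_toEuclideanLin H⁻¹) hinv, ← hpp', ← hqq',
    hp'.klDiv_eq_lintegral_fisherDensity hq']
  refine setLIntegral_congr_fun measurableSet_Ioi fun σ hσ => ?_
  have hσ : 0 < σ := hσ
  congr 1
  have hscore {a a' : EuclideanSpace ℝ (Fin n) → ℝ} (ha : IsProbDensity a)
      (haa' : densityMeasure a' = (densityMeasure a).map H.toEuclideanLin) :
      noisyMeasurementScore H a σ =
        gradient fun y' => Real.log (gaussianSmoothing σ (densityMeasure a') y') := by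
    ext1 v
    rw [noisyMeasurementScore, noisyMeasurementDensity_eq ha, haa']
  have hlaw : HasLaw (fun ω => H.toEuclideanLin (x ω)) (densityMeasure p') P := by
    refine HasLaw.fun_comp (μ := densityMeasure p) ⟨hm.aemeasurable, hpp'.symm⟩ hx
  have hnoise' := hnoise σ hσ
  rw [multivariateGaussian_eq_densityMeasure hσ] at hnoise'
  have hind : IndepFun (fun ω => H.toEuclideanLin (x ω)) (noise σ) P :=
    (hindep σ hσ).comp hm measurable_id
  simp_rw [hy σ hσ]
  rw [hscore hp hpp', hscore hq hqq']
  have hF : Measurable fun v : EuclideanSpace ℝ (Fin n) => ENNReal.ofReal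
      (‖gradient (fun y' => Real.log (gaussianSmoothing σ (densityMeasure p') y')) v -
        gradient (fun y' => Real.log (gaussianSmoothing σ (densityMeasure q') y')) v‖ ^ 2) :=
    (((measurable_gradient_log_gaussianSmoothing hσ).sub
      (measurable_gradient_log_gaussianSmoothing hσ)).norm.pow_const 2).ennreal_ofReal
  -- The expectation over signal and noise becomes an integral against p_σ, which is the weight
  -- inside the Fisher density.
  rw [lintegral_noise_eq hlaw hnoise' hind hσ hF]
  refine lintegral_congr fun v => ?_
  rw [sum_fisherDensity_eq hσ, ENNReal.ofReal_mul (by positivity)]
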